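/- Let $m\ge 1$ be an integer and $\lambda\in\mathbb T$ (the unit circle). Let $\mathcal D_\lambda^m=\{f=p+(z-\lambda)^mh:\ p \text{ a polynomial of degree}<m,\ h\in H^2\}$ be the local Dirichlet space of order $m$ at $\lambda$, with norm $\|f\|^2=\|f\|_{H^2}^2+\|h\|_{H^2}^2$, and let $T=M_z$ be multiplication by $z$ on it. Put $\Delta^{(0)}=I$ and $\Delta^{(i)}=T^*\Delta^{(i-1)}T-\Delta^{(i-1)}$. For a distribution $\mu$ on $\mathbb T$ write $\hat\mu(k)=\mu(\bar\zeta^k)$ $(k\in\mathbb Z)$ and let $P_\mu(z)=\sum_{k\ge0}\hat\mu(k)z^k+\sum_{k\ge1}\hat\mu(-k)\bar z^k$ be its Poisson extension to the open unit disc $\mathbb D$; let $D$ be the operator on distributions with $\widehat{D\mu}(k)=|k|\hat\mu(k)$. The order of $\mu$ is the least $N\in\mathbb Z_{\ge0}$ with $|\hat\mu(k)|\le C(1+|k|)^N$ for all $k$ and some constant $C$. Let $\mathcal D_a$ be the space of $C^\infty$ functions $f$ on $\mathbb T$ with $\hat f(k)=0$ for $k<0$, each identified with its analytic extension $\sum_{k\ge0}\hat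 f(k)z^k$ to $\mathbb D$. For a distribution $\mu$ and $f\in\mathcal D_a$ put $$D_{\mu,0}(f)=\lim_{r\to1^-}\int_{\mathbb T}|f(rz)|^2P_\mu(rz)\frac{|dz|}{2\pi},\qquad D_{\mu,i}(f)=\lim_{r\to1^-}\frac1{\pi\, i!\,(i-1)!}\int_{r\mathbb D}|f^{(i)}(z)|^2P_\mu(z)(1-|z|^2)^{i-1}\,dA(z)\quad(i\ge1),$$ and for a tuple $\vec\mu=(\mu_0,\dots,\mu_{n-1})$ put $\|f\|_{\vec\mu}^2=\sum_{i=0}^{n-1}D_{\mu_i,i}(f)$. The tuple is called normalized allowable if $\|1\|_{\vec\mu}^2=1$ and there is $C>0$ with $0\le\|zf\|_{\vec\mu}^2\le C\|f\|_{\vec\mu}^2$ for all $f\in\mathcal D_a$; then $\mathcal D_{\vec\mu}$ denotes the completion of $\mathcal D_a$, modulo functions of norm $0$, with respect to $\|\cdot\|_{\vec\mu}$. Then $T$ is a bounded operator on $\mathcal D_\lambda^m$ which is expansive ($\|Tf\|\ge\|f\|$) and a strict $2m$-isometry ($\Delta^{(2m)}=0\ne\Delta^{(2m-1)}$), and the constant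 function $1$ is a cyclic unit vector for $T$. There is exactly one $2m$-tuple of distributions $\vec\mu=(\mu_0,\dots,\mu_{2m-1})$ on $\mathbb T$ with $$\hat\mu_i(k)=\overline{\hat\mu_i(-k)}=\langle\Delta^{(i)}1,T^k1\rangle_{\mathcal D_\lambda^m}\qquad(k\ge0,\ 0\le i\le 2m-1).$$ This tuple is normalized allowable, and $\mathcal D_{\vec\mu}=\mathcal D_\lambda^m$: the space $\mathcal D_a$ is contained in $\mathcal D_\lambda^m$ as a dense subspace, and $\|f\|_{\vec\mu}=\|f\|_{\mathcal D_\lambda^m}$ for $f\in\mathcal D_a$. It is given by $\mu_0=\frac{|dz|}{2\pi}$, $$\mu_i=\binom{i-1}{m-1}\frac{\prod_{j=i+1-m}^{m-1}(D+j)}{(2m-1-i)!}\,\delta_\lambda\qquad(1\le i\le 2m-2),\qquad \mu_{2m-1}=\binom{2m-2}{m-1}\delta_\lambda ,$$ where $\binom{n}{j}=0$ for $j>n$. In particular $\mu_i=0$ for $1\le i\le m-1$, and $\mu_i$ has order $2m-1-i$ for $m\le i\le 2m-1$. -/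

import Mathlib

open scoped ComplexConjugate Topology ContDiff Nat

noncomputable section

namespace HigherDirichlet

/-! ### The Hardy space and the higher order local Dirichlet spaces -/

/-- The Hardy space `H²` of the disc: square-summable sequences of Taylor coefficients, the
sequence `f` standing for the analytic function `z ↦ ∑ fₙ zⁿ` on the open unit disc. -/
abbrev H2 : Type := lp (fun _ : ℕ => ℂ) 2

/-- The value of `f ∈ H²` at the point `z` (meaningful for `|z| < 1`). -/
def H2.eval (f : H2) (z : ℂ) : ℂ := ∑' n : ℕ, f n * z ^ n

/-- The Szegő kernel at `z`, used to see that point evaluations are continuous. -/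
def H2.kernel (z : ℂ) (hz : ‖z‖ < 1) : H2 :=
  ⟨fun n => conj z ^ n, by
    apply memℓp_gen
    have h : Summable fun n : ℕ => (‖z‖ ^ 2) ^ n :=
      summable_geometric_of_lt_one (by positivity) (by nlinarith [norm_nonneg z])
    refine h.congr fun n => ?_
    simp [← pow_mul, mul_comm]⟩

theorem H2.eval_eq_inner (f : H2) (z : ℂ) (hz : ‖z‖ < 1) :
    f.eval z = inner ℂ (H2.kernel z hz) f := by
  rw [lp.inner_eq_tsum, H2.eval]
  refine tsum_congr fun n => ?_
  simp [H2.kernel]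

theorem H2.eval_add (f g : H2) (z : ℂ) (hz : ‖z‖ < 1) :
    (f + g).eval z = f.eval z + g.eval z := by
  simp only [H2.eval_eq_inner _ z hz, inner_add_right]

theorem H2.eval_smul (c : ℂ) (f : H2) (z : ℂ) (hz : ‖z‖ < 1) :
    (c • f).eval z = c * f.eval z := by
  simp only [H2.eval_eq_inner _ z hz, inner_smul_right]

theorem H2.eval_zero (z : ℂ) (hz : ‖z‖ < 1) : (0 : H2).eval z = 0 := by
  simp only [H2.eval_eq_inner _ z hz, inner_zero_right]

theorem H2.continuous_eval (z : ℂ) (hz : ‖z‖ < 1) : Continuous fun f : H2 => f.eval z := by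
  simp only [H2.eval_eq_inner _ z hz]
  fun_prop

theorem H2.norm_eval_sq_le (f : H2) (z : ℂ) (hz : ‖z‖ < 1) :
    ‖f.eval z‖ ^ 2 * (1 - ‖z‖ ^ 2) ≤ ‖f‖ ^ 2 := by
  have h1 : ‖H2.kernel z hz‖ ^ 2 = (1 - ‖z‖ ^ 2)⁻¹ := by
    have h := lp.norm_rpow_eq_tsum (p := 2) (by norm_num) (H2.kernel z hz)
    have h2 : (2 : ENNReal).toReal = ((2 : ℕ) : ℝ) := by norm_num
    rw [h2, Real.rpow_natCast] at h
    rw [h, ← tsum_geometric_of_lt_one (by positivity) (by nlinarith [norm_nonneg z])]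
    refine tsum_congr fun n => ?_
    rw [Real.rpow_natCast]
    simp [H2.kernel, ← pow_mul, mul_comm]
  have h2 : 0 < 1 - ‖z‖ ^ 2 := by nlinarith [norm_nonneg z]
  have h3 : ‖f.eval z‖ ≤ ‖H2.kernel z hz‖ * ‖f‖ := by
    rw [H2.eval_eq_inner f z hz]; exact norm_inner_le_norm _ _
  calc ‖f.eval z‖ ^ 2 * (1 - ‖z‖ ^ 2)
      ≤ (‖H2.kernel z hz‖ * ‖f‖) ^ 2 * (1 - ‖z‖ ^ 2) := by gcongr
    _ = ‖f‖ ^ 2 := by rw [mul_pow, h1]; field_simp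

theorem H2.hasSum_eval (f : H2) (z : ℂ) (hz : ‖z‖ < 1) :
    HasSum (fun n : ℕ => f n * z ^ n) (f.eval z) := by
  refine Summable.hasSum ((lp.summable_inner (𝕜 := ℂ) (H2.kernel z hz) f).congr fun n => ?_)
  simp [H2.kernel]

theorem H2.eq_zero_of_eval (f : H2) (h : ∀ z : ℂ, ‖z‖ < 1 → f.eval z = 0) : f = 0 := by
  have h1 : HasFPowerSeriesAt (fun _ : ℂ => (0 : ℂ))
      (FormalMultilinearSeries.ofScalars ℂ fun n => f n) 0 := by
    rw [hasFPowerSeriesAt_iff]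
    filter_upwards [Metric.ball_mem_nhds (0 : ℂ) one_pos] with z hz
    have hz' : ‖z‖ < 1 := by simpa using hz
    have := H2.hasSum_eval f z hz'
    rw [h z hz'] at this
    simpa [FormalMultilinearSeries.coeff_ofScalars, mul_comm] using this
  have h2 := h1.eq_zero
  ext n
  have h3 := congrArg (fun p => FormalMultilinearSeries.coeff p n) h2
  rw [FormalMultilinearSeries.coeff_ofScalars] at h3
  rw [h3]
  simp [FormalMultilinearSeries.coeff]

/-- Multiplication by `z` on `H²`. -/
def H2.mulZ (f : H2) : H2 :=
  ⟨fun n => n.casesOn 0 fun k => f k, by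
    apply memℓp_gen
    have h := (lp.memℓp f).summable (by norm_num)
    rw [← summable_nat_add_iff 1]
    exact h⟩

theorem H2.eval_mulZ (f : H2) (z : ℂ) (hz : ‖z‖ < 1) : (H2.mulZ f).eval z = z * f.eval z := by
  have h := H2.hasSum_eval (H2.mulZ f) z hz
  rw [← hasSum_nat_add_iff' 1] at h
  have h2 := (H2.hasSum_eval f z hz).mul_left z
  have h3 := h.unique (by
    refine h2.congr_fun fun n => ?_
    simp only [H2.mulZ]
    ring)
  simpa [H2.mulZ] using h3

/-- The constant function `c`. -/
def H2.const (c : ℂ) : H2 := lp.single 2 0 c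

theorem H2.eval_const (c z : ℂ) : (H2.const c).eval z = c := by
  rw [H2.eval, tsum_eq_single 0]
  · simp [H2.const]
  · intro n hn
    simp [H2.const, hn]

/-- The local Dirichlet space `D_λ^m` of order `m` at `λ ∈ 𝕋`: all
`f = p + (z - λ)^m h` with `p` a polynomial of degree `< m` and `h ∈ H²`, with the norm
`‖f‖² = ‖f‖²_{H²} + ‖h‖²_{H²}`. The element `f` is stored together with `h` as the pair
`(f, h)` in the Hilbert sum `H² ⊕ H²`, whose norm induces exactly the required one;
`h` is determined by `f`, see `LocalDirichlet.eval_injective`. -/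
def LocalDirichlet (m : ℕ) (lam : Circle) : Submodule ℂ (WithLp 2 (H2 × H2)) where
  carrier := {F | ∃ p : Polynomial ℂ, p ∈ Polynomial.degreeLT ℂ m ∧
    ∀ z : ℂ, ‖z‖ < 1 → F.fst.eval z = p.eval z + (z - lam) ^ m * F.snd.eval z}
  add_mem' := by
    rintro F G ⟨p, hp, hF⟩ ⟨q, hq, hG⟩
    refine ⟨p + q, Submodule.add_mem _ hp hq, fun z hz => ?_⟩
    simp only [WithLp.add_fst, WithLp.add_snd, H2.eval_add _ _ z hz, hF z hz, hG z hz,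
      Polynomial.eval_add]
    ring
  zero_mem' := ⟨0, Submodule.zero_mem _, fun z hz => by simp [H2.eval_zero z hz]⟩
  smul_mem' := by
    rintro c F ⟨p, hp, hF⟩
    refine ⟨c • p, Submodule.smul_mem _ c hp, fun z hz => ?_⟩
    simp only [WithLp.smul_fst, WithLp.smul_snd, H2.eval_smul _ _ z hz, hF z hz,
      Polynomial.eval_smul, smul_eq_mul]
    ring

namespace LocalDirichlet

variable {m : ℕ} {lam : Circle}

/-- The value at `z`, `|z| < 1`, of an element of `D_λ^m` as an analytic function. -/
def eval (F : LocalDirichlet m lam) (z : ℂ) : ℂ := (F : WithLp 2 (H2 × H2)).fst.eval z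

theorem eval_add (F G : LocalDirichlet m lam) (z : ℂ) (hz : ‖z‖ < 1) :
    eval (F + G) z = eval F z + eval G z := H2.eval_add _ _ z hz

theorem eval_smul (c : ℂ) (F : LocalDirichlet m lam) (z : ℂ) (hz : ‖z‖ < 1) :
    eval (c • F) z = c * eval F z := H2.eval_smul _ _ z hz

theorem continuous_eval (z : ℂ) (hz : ‖z‖ < 1) :
    Continuous fun F : LocalDirichlet m lam => eval F z :=
  (H2.continuous_eval z hz).comp
    ((WithLp.continuous_fst 2 H2 H2).comp continuous_subtype_val)

theorem sub_ne_zero_of_norm_lt {z : ℂ} (hz : ‖z‖ < 1) (lam : Circle) : z - lam ≠ 0 := by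
  intro h
  rw [sub_eq_zero] at h
  rw [h, Circle.norm_coe] at hz
  exact lt_irrefl _ hz

theorem poly_eq_zero (p : Polynomial ℂ) (hp : p ∈ Polynomial.degreeLT ℂ m) (h : H2)
    (hh : ∀ z : ℂ, ‖z‖ < 1 → p.eval z + (z - lam) ^ m * h.eval z = 0) : p = 0 := by
  by_contra hp0
  obtain ⟨q, hq, hqd⟩ := Polynomial.exists_eq_pow_rootMultiplicity_mul_and_not_dvd p hp0 (lam : ℂ)
  set s := p.rootMultiplicity (lam : ℂ)
  have hs : s < m := by
    rw [Polynomial.mem_degreeLT] at hp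
    have h1 : p.natDegree < m := (Polynomial.natDegree_lt_iff_degree_lt hp0).2 hp
    have h2 := Polynomial.natDegree_le_of_dvd (Dvd.intro _ hq.symm) hp0
    rw [(Polynomial.monic_X_sub_C (lam : ℂ)).natDegree_pow, Polynomial.natDegree_X_sub_C,
      mul_one] at h2
    exact lt_of_le_of_lt h2 h1
  have hqn : q.eval (lam : ℂ) ≠ 0 := fun h0 => hqd (Polynomial.dvd_iff_isRoot.2 h0)
  obtain ⟨t, rfl⟩ : ∃ t, m = s + (t + 1) := ⟨m - s - 1, by omega⟩
  have key : ∀ r : ℝ, 0 < r → r < 1 →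
      ‖q.eval ((r : ℂ) * lam)‖ ^ 2 * (1 + r) ≤ (1 - r) * ‖h‖ ^ 2 := by
    intro r hr0 hr1
    have hz : ‖(r : ℂ) * lam‖ < 1 := by simpa [abs_of_pos hr0, Circle.norm_coe] using hr1
    have hn : ‖(r : ℂ) * lam‖ = r := by simp [abs_of_pos hr0, Circle.norm_coe]
    have h0 := hh _ hz
    have hne := sub_ne_zero_of_norm_lt hz lam
    have hd : ‖(r : ℂ) * lam - lam‖ = 1 - r := by
      have : (r : ℂ) * lam - lam = ((r - 1 : ℝ) : ℂ) * lam := by push_cast; ring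
      rw [this, norm_mul, Circle.norm_coe, mul_one, Complex.norm_real, Real.norm_eq_abs,
        abs_of_neg (by linarith)]
      ring
    rw [hq] at h0
    simp only [Polynomial.eval_mul, Polynomial.eval_pow, Polynomial.eval_sub, Polynomial.eval_X,
      Polynomial.eval_C] at h0
    have h1 : q.eval ((r : ℂ) * lam) = -(((r : ℂ) * lam - lam) ^ (t + 1) * h.eval (r * lam)) := by
      apply mul_left_cancel₀ (pow_ne_zero s hne)
      rw [pow_add] at h0
      linear_combination h0
    have h2 := H2.norm_eval_sq_le h _ hz
    rw [hn] at h2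
    rw [h1, norm_neg, norm_mul, norm_pow, hd]
    have h3 : (1 - r) ^ (t + 1) ≤ 1 - r := by
      rw [pow_succ]
      exact mul_le_of_le_one_left (by linarith) (pow_le_one₀ (by linarith) (by linarith))
    have h4 : 0 ≤ (1 - r) ^ (t + 1) := pow_nonneg (by linarith) _
    calc ((1 - r) ^ (t + 1) * ‖h.eval (r * lam)‖) ^ 2 * (1 + r)
        ≤ ((1 - r) * ‖h.eval (r * lam)‖) ^ 2 * (1 + r) := by gcongr
      _ = (1 - r) * (‖h.eval (r * lam)‖ ^ 2 * (1 - r ^ 2)) := by ring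
      _ ≤ (1 - r) * ‖h‖ ^ 2 := by
          apply mul_le_mul_of_nonneg_left h2; linarith
  have hl : Filter.Tendsto (fun r : ℝ => ‖q.eval ((r : ℂ) * lam)‖ ^ 2 * (1 + r)) (𝓝[<] 1)
      (𝓝 (‖q.eval (((1 : ℝ) : ℂ) * lam)‖ ^ 2 * (1 + 1))) := by
    apply Filter.Tendsto.mono_left _ nhdsWithin_le_nhds
    apply Continuous.tendsto
    have := q.continuous
    fun_prop
  have hr : Filter.Tendsto (fun r : ℝ => (1 - r) * ‖h‖ ^ 2) (𝓝[<] 1)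
      (𝓝 ((1 - 1) * ‖h‖ ^ 2)) := by
    apply Filter.Tendsto.mono_left _ nhdsWithin_le_nhds
    apply Continuous.tendsto
    fun_prop
  have hle := le_of_tendsto_of_tendsto hl hr (by
    filter_upwards [Ioo_mem_nhdsLT (zero_lt_one' ℝ)] with r hr
    exact key r hr.1 hr.2)
  have hpos : 0 < ‖q.eval (lam : ℂ)‖ := norm_pos_iff.2 hqn
  simp only [Complex.ofReal_one, one_mul] at hle
  nlinarith

/-- An element of `D_λ^m` is determined by its values on the disc. -/
theorem eval_injective (F G : LocalDirichlet m lam)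
    (h : ∀ z : ℂ, ‖z‖ < 1 → eval F z = eval G z) : F = G := by
  rw [← sub_eq_zero]
  have hE : ∀ z : ℂ, ‖z‖ < 1 → eval (F - G) z = 0 := fun z hz => by
    have h1 := eval_add (F - G) G z hz
    rw [sub_add_cancel, h z hz] at h1
    linear_combination -h1
  obtain ⟨p, hp, hF⟩ := (F - G).2
  have hp0 : p = 0 := poly_eq_zero (lam := lam) p hp _ fun z hz => by
    rw [← hF z hz]; exact hE z hz
  have h1 : ((F - G : LocalDirichlet m lam) : WithLp 2 (H2 × H2)).fst = 0 :=
    H2.eq_zero_of_eval _ hE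
  have h2 : ((F - G : LocalDirichlet m lam) : WithLp 2 (H2 × H2)).snd = 0 := by
    refine H2.eq_zero_of_eval _ fun z hz => ?_
    have h3 := hF z hz
    rw [h1, H2.eval_zero z hz, hp0, Polynomial.eval_zero, zero_add] at h3
    exact (mul_eq_zero.1 h3.symm).resolve_left
      (pow_ne_zero _ (sub_ne_zero_of_norm_lt hz lam))
  apply Subtype.ext
  apply (WithLp.equiv 2 (H2 × H2)).injective
  exact Prod.ext h1 h2

theorem isClosed (m : ℕ) (lam : Circle) :
    IsClosed (LocalDirichlet m lam : Set (WithLp 2 (H2 × H2))) := by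
  let L : Polynomial ℂ →ₗ[ℂ] (Metric.ball (0 : ℂ) 1 → ℂ) :=
    { toFun := fun p z => p.eval (z : ℂ)
      map_add' := fun p q => by ext z; simp
      map_smul' := fun c p => by ext z; simp }
  let V : Submodule ℂ (Metric.ball (0 : ℂ) 1 → ℂ) := (Polynomial.degreeLT ℂ m).map L
  have : FiniteDimensional ℂ (Polynomial.degreeLT ℂ m) :=
    (Polynomial.degreeLTEquiv ℂ m).symm.finiteDimensional
  have hV : IsClosed (V : Set (Metric.ball (0 : ℂ) 1 → ℂ)) := V.closed_of_finiteDimensional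
  let Φ : WithLp 2 (H2 × H2) → (Metric.ball (0 : ℂ) 1 → ℂ) :=
    fun F z => F.fst.eval z - ((z : ℂ) - lam) ^ m * F.snd.eval z
  have hΦ : Continuous Φ := by
    refine continuous_pi fun z => ?_
    have hz : ‖(z : ℂ)‖ < 1 := mem_ball_zero_iff.1 z.2
    have h1 := (H2.continuous_eval z hz).comp (WithLp.continuous_fst 2 H2 H2)
    have h2 := (H2.continuous_eval z hz).comp (WithLp.continuous_snd 2 H2 H2)
    exact h1.sub (continuous_const.mul h2)
  convert hV.preimage hΦ using 1
  ext F
  constructor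
  · rintro ⟨p, hp, hF⟩
    refine ⟨p, hp, ?_⟩
    ext z
    have hz : ‖(z : ℂ)‖ < 1 := mem_ball_zero_iff.1 z.2
    simp [L, Φ, hF z hz]
  · rintro ⟨p, hp, hF⟩
    refine ⟨p, hp, fun z hz => ?_⟩
    have h1 := congrFun hF ⟨z, by simpa using hz⟩
    simp only [L, Φ, LinearMap.coe_mk, AddHom.coe_mk] at h1
    rw [h1]; ring

instance : CompleteSpace (LocalDirichlet m lam) :=
  (isClosed m lam).completeSpace_coe

theorem exists_shift (F : LocalDirichlet m lam) :
    ∃ G : LocalDirichlet m lam, ∀ z : ℂ, ‖z‖ < 1 → eval G z = z * eval F z := by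
  obtain ⟨⟨f, h⟩, p, hp, hF⟩ := F
  rw [Polynomial.mem_degreeLT, Polynomial.degree_lt_iff_coeff_zero] at hp
  set c := p.coeff (m - 1)
  have hq : Polynomial.X * p - Polynomial.C c * (Polynomial.X - Polynomial.C (lam : ℂ)) ^ m ∈
      Polynomial.degreeLT ℂ m := by
    rw [Polynomial.mem_degreeLT, Polynomial.degree_lt_iff_coeff_zero]
    intro n hn
    have hmon : ((Polynomial.X - Polynomial.C (lam : ℂ)) ^ m).Monic :=
      (Polynomial.monic_X_sub_C _).pow m
    have hdeg : ((Polynomial.X - Polynomial.C (lam : ℂ)) ^ m).natDegree = m := by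
      simp [(Polynomial.monic_X_sub_C (lam : ℂ)).natDegree_pow]
    rw [Polynomial.coeff_sub, Polynomial.coeff_C_mul]
    rcases hn.eq_or_lt with rfl | hlt
    · have h1 := hmon.coeff_natDegree
      rw [hdeg] at h1
      rw [h1]
      rcases m with _ | m
      · simp [c, hp 0 le_rfl]
      · simp [c, Polynomial.coeff_X_mul]
    · rw [Polynomial.coeff_eq_zero_of_natDegree_lt
        (p := (Polynomial.X - Polynomial.C (lam : ℂ)) ^ m) (by rw [hdeg]; exact hlt)]
      obtain ⟨n, rfl⟩ : ∃ k, n = k + 1 := ⟨n - 1, by omega⟩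
      rw [Polynomial.coeff_X_mul, hp n (by omega)]
      simp
  refine ⟨⟨WithLp.toLp 2 (H2.mulZ f, H2.mulZ h + H2.const c), _, hq, ?_⟩, ?_⟩
  · intro z hz
    have h1 := hF z hz
    simp only [H2.eval_mulZ _ z hz, H2.eval_add _ _ z hz, H2.eval_const, WithLp.fst, WithLp.snd]
      at h1 ⊢
    rw [h1]
    simp
    ring
  · intro z hz
    exact H2.eval_mulZ _ z hz

theorem one_mem (hm : 1 ≤ m) :
    WithLp.toLp 2 (H2.const 1, (0 : H2)) ∈ LocalDirichlet m lam := by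
  refine ⟨1, ?_, fun z hz => ?_⟩
  · rw [Polynomial.mem_degreeLT]
    exact lt_of_le_of_lt Polynomial.degree_one_le (by exact_mod_cast hm)
  · simp [H2.eval_const, H2.eval_zero z hz]

/-- The constant function `1`, an element of `D_λ^m` for `m ≥ 1`. -/
def one (m : ℕ) (lam : Circle) (hm : 1 ≤ m) : LocalDirichlet m lam :=
  ⟨WithLp.toLp 2 (H2.const 1, (0 : H2)), one_mem hm⟩

end LocalDirichlet

/-- The shift `M_z`, `f ↦ z f`, as a linear map on `D_λ^m`. -/
def shiftLin (m : ℕ) (lam : Circle) : LocalDirichlet m lam →ₗ[ℂ] LocalDirichlet m lam where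
  toFun F := (LocalDirichlet.exists_shift F).choose
  map_add' F G := by
    apply LocalDirichlet.eval_injective
    intro z hz
    rw [LocalDirichlet.eval_add _ _ z hz, (LocalDirichlet.exists_shift (F + G)).choose_spec z hz,
      (LocalDirichlet.exists_shift F).choose_spec z hz,
      (LocalDirichlet.exists_shift G).choose_spec z hz, LocalDirichlet.eval_add _ _ z hz, mul_add]
  map_smul' c F := by
    apply LocalDirichlet.eval_injective
    intro z hz
    rw [RingHom.id_apply, LocalDirichlet.eval_smul _ _ z hz,
      (LocalDirichlet.exists_shift (c • F)).choose_spec z hz,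
      (LocalDirichlet.exists_shift F).choose_spec z hz, LocalDirichlet.eval_smul _ _ z hz]
    ring

theorem eval_shiftLin (m : ℕ) (lam : Circle) (F : LocalDirichlet m lam) (z : ℂ) (hz : ‖z‖ < 1) :
    LocalDirichlet.eval (shiftLin m lam F) z = z * LocalDirichlet.eval F z :=
  (LocalDirichlet.exists_shift F).choose_spec z hz

/-- The shift `M_z` as a bounded operator on `D_λ^m` (bounded by the closed graph theorem). -/
def shift (m : ℕ) (lam : Circle) : LocalDirichlet m lam →L[ℂ] LocalDirichlet m lam where
  toLinearMap := shiftLin m lam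
  cont := by
    apply LinearMap.continuous_of_seq_closed_graph
    intro u F G hu hG
    apply LocalDirichlet.eval_injective
    intro z hz
    have hc := LocalDirichlet.continuous_eval (m := m) (lam := lam) z hz
    have h1 := (hc.tendsto G).comp hG
    have h2 := ((hc.tendsto F).comp hu).const_mul z
    rw [eval_shiftLin m lam F z hz]
    refine tendsto_nhds_unique h1 (h2.congr fun n => ?_)
    simp only [Function.comp]
    rw [eval_shiftLin m lam _ z hz]

/-- `M_z` is multiplication by the independent variable. -/
theorem eval_shift (m : ℕ) (lam : Circle) (F : LocalDirichlet m lam) (z : ℂ) (hz : ‖z‖ < 1) :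
    LocalDirichlet.eval (shift m lam F) z = z * LocalDirichlet.eval F z :=
  eval_shiftLin m lam F z hz

/-! ### Test functions and distributions on the unit circle -/

/-- The space of `C^∞` functions on the unit circle. -/
def testSubmodule : Submodule ℂ (Circle → ℂ) where
  carrier := {f | ContDiff ℝ ∞ fun t : ℝ => f (Circle.exp t)}
  add_mem' := fun {f g} (hf : ContDiff ℝ ∞ fun t : ℝ => f (Circle.exp t))
    (hg : ContDiff ℝ ∞ fun t : ℝ => g (Circle.exp t)) => hf.add hg
  zero_mem' := show ContDiff ℝ ∞ fun _ : ℝ => (0 : ℂ) from contDiff_const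
  smul_mem' := fun c f (hf : ContDiff ℝ ∞ fun t : ℝ => f (Circle.exp t)) => hf.const_smul c

/-- The type of `C^∞` functions on the unit circle. -/
abbrev TestFun : Type := testSubmodule

/-- The `2π`-periodic function `t ↦ f (e^{it})`. -/
def TestFun.lift (f : TestFun) : ℝ → ℂ := fun t => (f : Circle → ℂ) (Circle.exp t)

theorem TestFun.contDiff_lift (f : TestFun) : ContDiff ℝ ∞ f.lift := f.2

theorem TestFun.lift_periodic (f : TestFun) : Function.Periodic f.lift (2 * Real.pi) := by
  intro t
  simp [TestFun.lift]

theorem TestFun.lift_add (f g : TestFun) : TestFun.lift (f + g) = f.lift + g.lift := rfl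

theorem TestFun.lift_smul (c : ℂ) (f : TestFun) : TestFun.lift (c • f) = c • f.lift := rfl

/-- The Fourier coefficient `∫ f(ζ) ζ̄^k |dζ| / 2π` of a test function. -/
def TestFun.coeff (f : TestFun) (k : ℤ) : ℂ :=
  (2 * Real.pi : ℂ)⁻¹ * ∫ t in (0 : ℝ)..2 * Real.pi, f.lift t * ((Circle.exp t ^ (-k) : Circle) : ℂ)

theorem contDiff_exp_zpow (k : ℤ) :
    ContDiff ℝ ∞ fun t : ℝ => ((Circle.exp t ^ k : Circle) : ℂ) := by
  have h : (fun t : ℝ => ((Circle.exp t ^ k : Circle) : ℂ)) =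
      fun t : ℝ => Complex.exp ((k * Complex.I) * (t : ℂ)) := by
    ext t
    rw [Circle.coe_zpow, Circle.coe_exp, ← Complex.exp_int_mul]
    ring_nf
  rw [h]
  exact (contDiff_const.mul Complex.ofRealCLM.contDiff).cexp

/-- The test function `ζ ↦ ζ^k`. -/
def monomial (k : ℤ) : TestFun := ⟨fun ζ => ((ζ ^ k : Circle) : ℂ), contDiff_exp_zpow k⟩

/-- The test function `ζ ↦ ζ f(ζ)`. -/
def TestFun.mulZ (f : TestFun) : TestFun :=
  ⟨fun ζ => (ζ : ℂ) * (f : Circle → ℂ) ζ, by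
    have h := (contDiff_exp_zpow 1).mul f.contDiff_lift
    simp only [zpow_one] at h
    exact h⟩

/-- Distributions on the circle: linear functionals `μ` on the `C^∞` functions that are
continuous, that is, bounded by a multiple of `max_{j ≤ N} sup |f^{(j)}|` for some `N`. -/
def distributionSubmodule : Submodule ℂ (Module.Dual ℂ TestFun) where
  carrier := {μ | ∃ (N : ℕ) (C : ℝ), ∀ (f : TestFun) (M : ℝ),
    (∀ j ≤ N, ∀ t : ℝ, ‖iteratedDeriv j f.lift t‖ ≤ M) → ‖μ f‖ ≤ C * M}
  add_mem' := by
    rintro μ ν ⟨N, C, h⟩ ⟨N', C', h'⟩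
    refine ⟨max N N', C + C', fun f M hM => ?_⟩
    have h1 := h f M fun j hj => hM j (hj.trans (le_max_left _ _))
    have h2 := h' f M fun j hj => hM j (hj.trans (le_max_right _ _))
    rw [LinearMap.add_apply, add_mul]
    exact (norm_add_le _ _).trans (add_le_add h1 h2)
  zero_mem' := ⟨0, 0, fun f M _ => by simp⟩
  smul_mem' := by
    rintro c μ ⟨N, C, h⟩
    refine ⟨N, ‖c‖ * C, fun f M hM => ?_⟩
    rw [LinearMap.smul_apply, norm_smul, mul_assoc]
    exact mul_le_mul_of_nonneg_left (h f M hM) (norm_nonneg c)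

/-- The type of distributions on the unit circle. -/
abbrev Distribution : Type := distributionSubmodule

/-- The Fourier coefficient `μ(ζ̄^k)` of a distribution. -/
def Distribution.coeff (μ : Distribution) (k : ℤ) : ℂ :=
  (μ : Module.Dual ℂ TestFun) (monomial (-k))

/-- The Dirac measure at `λ`. -/
def dirac (lam : Circle) : Distribution :=
  ⟨{ toFun := fun f => (f : Circle → ℂ) lam
     map_add' := fun _ _ => rfl
     map_smul' := fun _ _ => rfl }, ⟨0, 1, fun f M hM => by
      have h := hM 0 le_rfl (Complex.arg lam)
      rw [one_mul]
      simpa [TestFun.lift] using h⟩⟩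

theorem TestFun.intervalIntegrable (f : TestFun) (k : ℤ) :
    IntervalIntegrable (fun t : ℝ => f.lift t * ((Circle.exp t ^ (-k) : Circle) : ℂ))
      MeasureTheory.volume 0 (2 * Real.pi) :=
  (f.contDiff_lift.continuous.mul (contDiff_exp_zpow (-k)).continuous).intervalIntegrable _ _

theorem TestFun.coeff_add (f g : TestFun) (k : ℤ) :
    TestFun.coeff (f + g) k = f.coeff k + g.coeff k := by
  simp only [TestFun.coeff, TestFun.lift_add, Pi.add_apply, add_mul]
  rw [intervalIntegral.integral_add (f.intervalIntegrable k) (g.intervalIntegrable k), mul_add]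

theorem TestFun.coeff_smul (c : ℂ) (f : TestFun) (k : ℤ) :
    TestFun.coeff (c • f) k = c * f.coeff k := by
  simp only [TestFun.coeff, TestFun.lift_smul, Pi.smul_apply, smul_eq_mul, mul_assoc]
  rw [intervalIntegral.integral_const_mul]
  ring

theorem TestFun.coeff_mulZ (f : TestFun) (k : ℤ) :
    TestFun.coeff f.mulZ k = f.coeff (k - 1) := by
  rw [TestFun.coeff, TestFun.coeff]
  congr 1
  refine intervalIntegral.integral_congr fun t _ => ?_
  have h : Circle.exp t ^ (-(k - 1)) = Circle.exp t * Circle.exp t ^ (-k) := by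
    rw [← zpow_one_add]; congr 1; ring
  simp only [TestFun.lift, TestFun.mulZ, h, Circle.coe_mul]
  ring

theorem norm_integral_le {g : ℝ → ℂ} {M : ℝ} (hM : ∀ t, ‖g t‖ ≤ M) (k : ℤ) :
    ‖(2 * Real.pi : ℂ)⁻¹ * ∫ t in (0 : ℝ)..2 * Real.pi,
      g t * ((Circle.exp t ^ (-k) : Circle) : ℂ)‖ ≤ M := by
  have h := intervalIntegral.norm_integral_le_of_norm_le_const (a := 0) (b := 2 * Real.pi)
    (f := fun t => g t * ((Circle.exp t ^ (-k) : Circle) : ℂ)) (C := M) (fun t _ => by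
      rw [norm_mul, Circle.norm_coe, mul_one]; exact hM t)
  have hpi := Real.pi_pos
  have h2 : ‖(2 * Real.pi : ℂ)⁻¹‖ = (2 * Real.pi)⁻¹ := by
    simp [abs_of_pos hpi]
  rw [norm_mul, h2]
  rw [sub_zero, abs_of_pos (by positivity)] at h
  calc (2 * Real.pi)⁻¹ * _ ≤ (2 * Real.pi)⁻¹ * (M * (2 * Real.pi)) := by gcongr
    _ = M := by field_simp

/-- The Lebesgue measure `|dz| / 2π`, of total mass one. -/
def lebesgue : Distribution :=
  ⟨{ toFun := fun f => f.coeff 0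
     map_add' := fun f g => TestFun.coeff_add f g 0
     map_smul' := fun c f => TestFun.coeff_smul c f 0 }, ⟨0, 1, fun f M hM => by
      rw [one_mul]
      exact norm_integral_le (fun t => by simpa using hM 0 le_rfl t) 0⟩⟩

theorem hasDerivAt_exp_zpow (k : ℤ) (t : ℝ) :
    HasDerivAt (fun t : ℝ => ((Circle.exp t ^ k : Circle) : ℂ))
      (k * Complex.I * ((Circle.exp t ^ k : Circle) : ℂ)) t := by
  have h : (fun t : ℝ => ((Circle.exp t ^ k : Circle) : ℂ)) =
      fun t : ℝ => Complex.exp ((k * Complex.I) * (t : ℂ)) := by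
    ext t
    rw [Circle.coe_zpow, Circle.coe_exp, ← Complex.exp_int_mul]
    ring_nf
  have h2 : HasDerivAt (fun t : ℝ => (k * Complex.I) * (t : ℂ)) (k * Complex.I) t := by
    simpa using (Complex.ofRealCLM.hasDerivAt (x := t)).const_mul (k * Complex.I : ℂ)
  have h3 := h2.cexp
  rw [congrFun h t, h]
  convert h3 using 1
  ring

theorem iteratedDeriv_monomial (k : ℤ) (j : ℕ) :
    iteratedDeriv j (monomial k).lift =
      fun t => (k * Complex.I) ^ j * ((Circle.exp t ^ k : Circle) : ℂ) := by
  induction j with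
  | zero => ext t; simp [TestFun.lift, monomial]
  | succ j ih =>
    rw [iteratedDeriv_succ, ih]
    ext t
    rw [((hasDerivAt_exp_zpow k t).const_mul _).deriv]
    ring

/-- The Fourier coefficients of a distribution have at most polynomial growth. -/
theorem Distribution.growth (μ : Distribution) :
    ∃ (N : ℕ) (C : ℝ), ∀ k : ℤ, ‖μ.coeff k‖ ≤ C * (1 + |(k : ℝ)|) ^ N := by
  obtain ⟨N, C, h⟩ := μ.2
  refine ⟨N, C, fun k => h _ _ fun j hj t => ?_⟩
  rw [iteratedDeriv_monomial]
  have hk : (0 : ℝ) ≤ |(k : ℝ)| := abs_nonneg _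
  simp only [norm_mul, norm_pow, Circle.norm_coe, mul_one, Complex.norm_I, Int.cast_neg, norm_neg,
    Complex.norm_intCast]
  calc |(k : ℝ)| ^ j ≤ (1 + |(k : ℝ)|) ^ j := by gcongr; linarith
    _ ≤ (1 + |(k : ℝ)|) ^ N := pow_le_pow_right₀ (by linarith) hj

theorem integral_deriv_mul {g : ℝ → ℂ} (hg : ContDiff ℝ ∞ g)
    (hp : Function.Periodic g (2 * Real.pi)) (k : ℤ) :
    ∫ t in (0 : ℝ)..2 * Real.pi, deriv g t * ((Circle.exp t ^ (-k) : Circle) : ℂ) =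
      k * Complex.I *
        ∫ t in (0 : ℝ)..2 * Real.pi, g t * ((Circle.exp t ^ (-k) : Circle) : ℂ) := by
  have hd : Continuous (deriv g) := hg.continuous_deriv (by norm_num)
  have he := (contDiff_exp_zpow (-k)).continuous
  have h := intervalIntegral.integral_deriv_mul_eq_sub (a := 0) (b := 2 * Real.pi)
    (u := g) (v := fun t : ℝ => ((Circle.exp t ^ (-k) : Circle) : ℂ)) (u' := deriv g)
    (v' := fun t => ((-k : ℤ) : ℂ) * Complex.I * ((Circle.exp t ^ (-k) : Circle) : ℂ))
    (fun t _ => (hg.differentiable (by norm_num) t).hasDerivAt)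
    (fun t _ => hasDerivAt_exp_zpow (-k) t)
    (hd.intervalIntegrable _ _) ((continuous_const.mul he).intervalIntegrable _ _)
  have hg0 : g (2 * Real.pi) = g 0 := by simpa using hp 0
  have i1 : IntervalIntegrable (fun t => deriv g t * ((Circle.exp t ^ (-k) : Circle) : ℂ))
      MeasureTheory.volume 0 (2 * Real.pi) := (hd.mul he).intervalIntegrable _ _
  have i2 : IntervalIntegrable
      (fun t => g t * (((-k : ℤ) : ℂ) * Complex.I * ((Circle.exp t ^ (-k) : Circle) : ℂ)))
      MeasureTheory.volume 0 (2 * Real.pi) :=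
    (hg.continuous.mul (continuous_const.mul he)).intervalIntegrable _ _
  rw [hg0, intervalIntegral.integral_add i1 i2] at h
  have h2 : ∫ t in (0 : ℝ)..2 * Real.pi,
      g t * (((-k : ℤ) : ℂ) * Complex.I * ((Circle.exp t ^ (-k) : Circle) : ℂ)) =
      -(k * Complex.I *
        ∫ t in (0 : ℝ)..2 * Real.pi, g t * ((Circle.exp t ^ (-k) : Circle) : ℂ)) := by
    rw [← intervalIntegral.integral_const_mul, ← intervalIntegral.integral_neg]
    refine intervalIntegral.integral_congr fun t _ => ?_
    push_cast
    ring
  rw [h2] at h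
  simp only [Circle.exp_two_pi, Circle.exp_zero, one_zpow, sub_self] at h
  linear_combination h

theorem integral_iteratedDeriv_mul (j : ℕ) : ∀ {g : ℝ → ℂ}, ContDiff ℝ ∞ g →
    Function.Periodic g (2 * Real.pi) → ∀ k : ℤ,
    ∫ t in (0 : ℝ)..2 * Real.pi, iteratedDeriv j g t * ((Circle.exp t ^ (-k) : Circle) : ℂ) =
      (k * Complex.I) ^ j *
        ∫ t in (0 : ℝ)..2 * Real.pi, g t * ((Circle.exp t ^ (-k) : Circle) : ℂ) := by
  induction j with
  | zero => intro g _ _ k; simp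
  | succ j ih =>
    intro g hg hp k
    have hd : ContDiff ℝ ∞ (deriv g) := (contDiff_infty_iff_deriv.1 hg).2
    have hdp : Function.Periodic (deriv g) (2 * Real.pi) := fun t => by
      rw [← deriv_comp_add_const, funext hp]
    rw [iteratedDeriv_succ', ih hd hdp k, integral_deriv_mul hg hp k]
    ring

/-- The Fourier coefficients of a test function decay rapidly. -/
theorem TestFun.decay (f : TestFun) (N : ℕ) (M : ℝ)
    (hM : ∀ j ≤ N, ∀ t : ℝ, ‖iteratedDeriv j f.lift t‖ ≤ M) (k : ℤ) :
    ‖f.coeff k‖ * (1 + |(k : ℝ)|) ^ N ≤ 2 ^ N * M := by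
  have h : ∀ j ≤ N, |(k : ℝ)| ^ j * ‖f.coeff k‖ ≤ M := by
    intro j hj
    have h1 := norm_integral_le (hM j hj) k
    rw [integral_iteratedDeriv_mul j f.contDiff_lift f.lift_periodic k, mul_left_comm,
      norm_mul] at h1
    simpa [TestFun.coeff, Complex.norm_intCast] using h1
  have hk : (0 : ℝ) ≤ |(k : ℝ)| := abs_nonneg _
  have hn := norm_nonneg (f.coeff k)
  rcases le_total |(k : ℝ)| 1 with h1 | h1
  · calc ‖f.coeff k‖ * (1 + |(k : ℝ)|) ^ N ≤ ‖f.coeff k‖ * 2 ^ N := by gcongr; linarith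
      _ ≤ 2 ^ N * M := by
        rw [mul_comm]; gcongr; simpa using h 0 (Nat.zero_le _)
  · calc ‖f.coeff k‖ * (1 + |(k : ℝ)|) ^ N ≤ ‖f.coeff k‖ * (2 * |(k : ℝ)|) ^ N := by
          gcongr; linarith
      _ = 2 ^ N * (|(k : ℝ)| ^ N * ‖f.coeff k‖) := by rw [mul_pow]; ring
      _ ≤ 2 ^ N * M := by gcongr; exact h N le_rfl

theorem TestFun.exists_bound (f : TestFun) (N : ℕ) :
    ∃ M : ℝ, ∀ j ≤ N, ∀ t : ℝ, ‖iteratedDeriv j f.lift t‖ ≤ M := by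
  have hper : ∀ j : ℕ, Function.Periodic (iteratedDeriv j f.lift) (2 * Real.pi) := by
    intro j
    induction j with
    | zero => simpa using f.lift_periodic
    | succ j ih =>
      intro t
      rw [iteratedDeriv_succ, ← deriv_comp_add_const, funext ih]
  have h1 : ∀ j : ℕ, ∃ M : ℝ, ∀ t : ℝ, ‖iteratedDeriv j f.lift t‖ ≤ M := by
    intro j
    have hc : Continuous (iteratedDeriv j f.lift) :=
      f.contDiff_lift.continuous_iteratedDeriv j (by exact_mod_cast le_top)
    obtain ⟨M, hM⟩ := (isCompact_Icc (a := (0 : ℝ)) (b := 2 * Real.pi)).exists_bound_of_continuousOn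
      hc.continuousOn
    refine ⟨M, fun t => ?_⟩
    obtain ⟨s, hs, hst⟩ := (hper j).exists_mem_Ico₀ (by positivity) t
    rw [hst]
    exact hM s (Set.Ico_subset_Icc_self hs)
  choose M hM using h1
  refine ⟨∑ i ∈ Finset.range (N + 1), |M i|, fun j hj t => ?_⟩
  calc _ ≤ M j := hM j t
    _ ≤ |M j| := le_abs_self _
    _ ≤ _ := Finset.single_le_sum (f := fun i => |M i|) (fun _ _ => abs_nonneg _)
      (Finset.mem_range.2 (by omega))

theorem summable_inv_sq : Summable fun k : ℤ => ((1 + |(k : ℝ)|) ^ 2)⁻¹ := by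
  have h : Summable fun n : ℕ => ((1 + (n : ℝ)) ^ 2)⁻¹ := by
    have := (summable_nat_add_iff 1).2 (Real.summable_nat_pow_inv.2 (one_lt_two))
    refine this.congr fun n => ?_
    push_cast
    rw [add_comm]
  exact Summable.of_nat_of_neg (by simpa using h) (by simpa using h)

theorem pairing_bound {a : ℤ → ℂ} {N : ℕ} {C : ℝ} (ha : ∀ k, ‖a k‖ ≤ C * (1 + |(k : ℝ)|) ^ N)
    (f : TestFun) {M : ℝ} (hM : ∀ j ≤ N + 2, ∀ t : ℝ, ‖iteratedDeriv j f.lift t‖ ≤ M) (k : ℤ) :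
    ‖f.coeff k * a (-k)‖ ≤ C * (2 ^ (N + 2) * M) * ((1 + |(k : ℝ)|) ^ 2)⁻¹ := by
  have h1 := f.decay (N + 2) M hM k
  have h2 := ha (-k)
  rw [Int.cast_neg, abs_neg] at h2
  have hC : 0 ≤ C := by
    have := (norm_nonneg _).trans (ha 0)
    simpa using this
  have hk : (0 : ℝ) < 1 + |(k : ℝ)| := by positivity
  rw [norm_mul, ← div_eq_mul_inv, le_div_iff₀ (by positivity)]
  calc ‖f.coeff k‖ * ‖a (-k)‖ * (1 + |(k : ℝ)|) ^ 2
      ≤ ‖f.coeff k‖ * (C * (1 + |(k : ℝ)|) ^ N) * (1 + |(k : ℝ)|) ^ 2 := by gcongr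
    _ = C * (‖f.coeff k‖ * (1 + |(k : ℝ)|) ^ (N + 2)) := by rw [pow_add]; ring
    _ ≤ _ := by gcongr

theorem pairing_summable {a : ℤ → ℂ}
    (ha : ∃ (N : ℕ) (C : ℝ), ∀ k : ℤ, ‖a k‖ ≤ C * (1 + |(k : ℝ)|) ^ N) (f : TestFun) :
    Summable fun k : ℤ => f.coeff k * a (-k) := by
  obtain ⟨N, C, h⟩ := ha
  obtain ⟨M, hM⟩ := f.exists_bound (N + 2)
  exact Summable.of_norm_bounded (summable_inv_sq.mul_left _) (pairing_bound h f hM)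

/-- The distribution `f ↦ ∑ f̂(k) a(-k)`, with Fourier coefficients `a(k)` of polynomial growth. -/
def Distribution.ofCoeff (a : ℤ → ℂ)
    (ha : ∃ (N : ℕ) (C : ℝ), ∀ k : ℤ, ‖a k‖ ≤ C * (1 + |(k : ℝ)|) ^ N) : Distribution :=
  ⟨{ toFun := fun f => ∑' k : ℤ, f.coeff k * a (-k)
     map_add' := fun f g => by
      simp only [TestFun.coeff_add, add_mul]
      exact (pairing_summable ha f).tsum_add (pairing_summable ha g)
     map_smul' := fun c f => by
      simp only [TestFun.coeff_smul, mul_assoc, RingHom.id_apply, smul_eq_mul]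
      exact tsum_mul_left }, by
    obtain ⟨N, C, h⟩ := ha
    refine ⟨N + 2, C * 2 ^ (N + 2) * ∑' k : ℤ, ((1 + |(k : ℝ)|) ^ 2)⁻¹, fun f M hM => ?_⟩
    have h1 := tsum_of_norm_bounded (summable_inv_sq.hasSum.mul_left _) (pairing_bound h f hM)
    refine h1.trans (le_of_eq ?_)
    ring⟩

theorem coeff_monomial (j k : ℤ) : (monomial j).coeff k = if k = j then 1 else 0 := by
  have hpi : (Real.pi : ℂ) ≠ 0 := by exact_mod_cast Real.pi_ne_zero
  have h : ∀ t : ℝ, (monomial j).lift t * ((Circle.exp t ^ (-k) : Circle) : ℂ) =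
      ((Circle.exp t ^ (j - k) : Circle) : ℂ) := fun t => by
    simp only [TestFun.lift, monomial]
    rw [← Circle.coe_mul, ← zpow_add, sub_eq_add_neg]
  simp only [TestFun.coeff, h]
  split_ifs with hk
  · subst hk
    simp
    field_simp
  · have hne : ((j - k : ℤ) : ℂ) * Complex.I ≠ 0 :=
      mul_ne_zero (by exact_mod_cast sub_ne_zero.2 (Ne.symm hk)) Complex.I_ne_zero
    have h2 := intervalIntegral.integral_eq_sub_of_hasDerivAt (a := 0) (b := 2 * Real.pi)
      (fun t _ => hasDerivAt_exp_zpow (j - k) t)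
      ((continuous_const.mul (contDiff_exp_zpow (j - k)).continuous).intervalIntegrable _ _)
    rw [intervalIntegral.integral_const_mul] at h2
    simp only [Circle.exp_two_pi, Circle.exp_zero, one_zpow, sub_self] at h2
    rw [(mul_eq_zero.1 h2).resolve_left hne, mul_zero]

theorem Distribution.coeff_ofCoeff (a : ℤ → ℂ)
    (ha : ∃ (N : ℕ) (C : ℝ), ∀ k : ℤ, ‖a k‖ ≤ C * (1 + |(k : ℝ)|) ^ N) (k : ℤ) :
    (Distribution.ofCoeff a ha).coeff k = a k := by
  change ∑' l : ℤ, (monomial (-k)).coeff l * a (-l) = a k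
  rw [tsum_eq_single (-k)]
  · simp [coeff_monomial]
  · intro l hl
    simp [coeff_monomial, hl]

theorem Distribution.growth_abs (μ : Distribution) :
    ∃ (N : ℕ) (C : ℝ), ∀ k : ℤ,
      ‖((|k| : ℤ) : ℂ) * μ.coeff k‖ ≤ C * (1 + |(k : ℝ)|) ^ N := by
  obtain ⟨N, C, h⟩ := μ.growth
  refine ⟨N + 1, C, fun k => ?_⟩
  have h1 := h k
  have hk : (0 : ℝ) ≤ |(k : ℝ)| := abs_nonneg _
  rw [norm_mul, Complex.norm_intCast]
  have h2 : |((|k| : ℤ) : ℝ)| ≤ 1 + |(k : ℝ)| := by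
    rw [Int.cast_abs, abs_abs]; linarith
  calc |((|k| : ℤ) : ℝ)| * ‖μ.coeff k‖ ≤ (1 + |(k : ℝ)|) * (C * (1 + |(k : ℝ)|) ^ N) := by gcongr
    _ = C * (1 + |(k : ℝ)|) ^ (N + 1) := by rw [pow_succ]; ring

/-- The modified differentiation operator `D` on distributions: the Fourier multiplier
`μ̂(k) ↦ |k| μ̂(k)`. -/
def absDeriv : Distribution →ₗ[ℂ] Distribution where
  toFun μ := Distribution.ofCoeff (fun k => ((|k| : ℤ) : ℂ) * μ.coeff k) μ.growth_abs
  map_add' μ ν := by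
    apply Subtype.ext
    ext f
    change ∑' k : ℤ, f.coeff k * (((|-k| : ℤ) : ℂ) * (μ.coeff (-k) + ν.coeff (-k))) =
      ∑' k : ℤ, f.coeff k * (((|-k| : ℤ) : ℂ) * μ.coeff (-k)) +
      ∑' k : ℤ, f.coeff k * (((|-k| : ℤ) : ℂ) * ν.coeff (-k))
    simp only [mul_add]
    exact (pairing_summable μ.growth_abs f).tsum_add (pairing_summable ν.growth_abs f)
  map_smul' c μ := by
    apply Subtype.ext
    ext f
    change ∑' k : ℤ, f.coeff k * (((|-k| : ℤ) : ℂ) * (c * μ.coeff (-k))) =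
      c * ∑' k : ℤ, f.coeff k * (((|-k| : ℤ) : ℂ) * μ.coeff (-k))
    rw [← tsum_mul_left]
    exact tsum_congr fun k => by ring

theorem coeff_absDeriv (μ : Distribution) (k : ℤ) :
    (absDeriv μ).coeff k = ((|k| : ℤ) : ℂ) * μ.coeff k :=
  Distribution.coeff_ofCoeff _ _ k

/-- `μ` has order `N`: `N` is the least natural number with `|μ̂(k)| ≲ (1 + |k|)^N`. -/
def Distribution.HasOrder (μ : Distribution) (N : ℕ) : Prop :=
  IsLeast {n : ℕ | ∃ C : ℝ, ∀ k : ℤ, ‖μ.coeff k‖ ≤ C * (1 + |(k : ℝ)|) ^ n} N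

/-! ### Harmonically weighted Dirichlet integrals and allowable tuples -/

/-- The Poisson extension `∑_{k ≥ 0} a(k) z^k + ∑_{k ≥ 1} a(-k) z̄^k` of the function or
distribution with Fourier coefficients `a`. -/
def poisson (a : ℤ → ℂ) (z : ℂ) : ℂ :=
  ∑' k : ℕ, a k * z ^ k + ∑' k : ℕ, a (-((k : ℤ) + 1)) * conj z ^ (k + 1)

/-- The test functions that are analytic: `f̂(k) = 0` for `k < 0`. -/
def analyticSubmodule : Submodule ℂ TestFun where
  carrier := {f | ∀ k : ℤ, k < 0 → f.coeff k = 0}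
  add_mem' hf hg k hk := by rw [TestFun.coeff_add, hf k hk, hg k hk, add_zero]
  zero_mem' k _ := by
    have := TestFun.coeff_smul 0 0 k
    simpa using this
  smul_mem' c f hf k hk := by rw [TestFun.coeff_smul, hf k hk, mul_zero]

/-- The type of analytic test functions. -/
abbrev AnalyticTest : Type := analyticSubmodule

/-- The extension of `f` to the disc, `z ↦ ∑ f̂(k) z^k`. -/
def AnalyticTest.extend (f : AnalyticTest) : ℂ → ℂ := poisson (f : TestFun).coeff

/-- The analytic test function `z f`. -/
def AnalyticTest.mulZ (f : AnalyticTest) : AnalyticTest :=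
  ⟨(f : TestFun).mulZ, fun k hk => by
    rw [TestFun.coeff_mulZ]; exact f.2 (k - 1) (by omega)⟩

/-- The constant function `1`. -/
def AnalyticTest.one : AnalyticTest :=
  ⟨monomial 0, fun k hk => by rw [coeff_monomial, if_neg hk.ne]⟩

/-- The integrals whose limit as `r → 1-` is the weighted Dirichlet integral of order `i`. -/
def dirichletApprox (μ : Distribution) : ℕ → AnalyticTest → ℝ → ℂ
  | 0, f, r => (2 * Real.pi : ℂ)⁻¹ * ∫ t in (0 : ℝ)..2 * Real.pi,
      (‖f.extend (r * (Circle.exp t : ℂ))‖ ^ 2 : ℝ) * poisson μ.coeff (r * (Circle.exp t : ℂ))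
  | i + 1, f, r => (Real.pi * (i + 1)! * i ! : ℂ)⁻¹ * ∫ z in Metric.ball (0 : ℂ) r,
      (‖iteratedDeriv (i + 1) f.extend z‖ ^ 2 : ℝ) * poisson μ.coeff z * ((1 - ‖z‖ ^ 2) ^ i : ℝ)

/-- The harmonically weighted Dirichlet integral `D_{μ,i}(f)` of order `i`. -/
def dirichletIntegral (μ : Distribution) (i : ℕ) (f : AnalyticTest) : ℂ :=
  Filter.limUnder (𝓝[<] (1 : ℝ)) (dirichletApprox μ i f)

/-- The quadratic form `‖f‖²_μ = ∑_{i < n} D_{μ_i,i}(f)` of an `n`-tuple of distributions. -/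
def tupleForm {n : ℕ} (μ : Fin n → Distribution) (f : AnalyticTest) : ℂ :=
  ∑ i : Fin n, dirichletIntegral (μ i) i f

open scoped ComplexOrder in
/-- `μ` is a normalized allowable `n`-tuple: `‖1‖²_μ = 1` and `0 ≤ ‖z f‖²_μ ≤ C ‖f‖²_μ` for all
analytic test functions `f`, the limits that define the form being genuine ones. The order on `ℂ`
is the one for which `0 ≤ w` says that `w` is real and non-negative. -/
structure IsNormalizedAllowable {n : ℕ} (μ : Fin n → Distribution) : Prop where
  tendsto : ∀ (i : Fin n) (f : AnalyticTest),
    Filter.Tendsto (dirichletApprox (μ i) i f) (𝓝[<] 1) (𝓝 (dirichletIntegral (μ i) i f))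
  form_one : tupleForm μ AnalyticTest.one = 1
  bounded : ∃ C : ℝ, 0 < C ∧ ∀ f : AnalyticTest,
    0 ≤ tupleForm μ f.mulZ ∧ tupleForm μ f.mulZ ≤ (C : ℂ) * tupleForm μ f

/-! ### Higher order isometries and their tuples -/

section Operators

variable {H : Type*} [NormedAddCommGroup H] [InnerProductSpace ℂ H] [CompleteSpace H]

/-- The defect operators: `Δ⁽⁰⁾ = I`, `Δ⁽ⁿ⁺¹⁾ = T* Δ⁽ⁿ⁾ T - Δ⁽ⁿ⁾`. -/
def defect (T : H →L[ℂ] H) : ℕ → (H →L[ℂ] H)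
  | 0 => ContinuousLinearMap.id ℂ H
  | n + 1 => (ContinuousLinearMap.adjoint T).comp ((defect T n).comp T) - defect T n

/-- `T` is expansive: `‖T x‖ ≥ ‖x‖`. -/
def IsExpansive (T : H →L[ℂ] H) : Prop := ∀ x : H, ‖x‖ ≤ ‖T x‖

/-- `T` is a strict `n`-isometry: an `n`-isometry but not an `(n-1)`-isometry (`n ≥ 1`). -/
def IsStrictIsometry (T : H →L[ℂ] H) (n : ℕ) : Prop := defect T n = 0 ∧ defect T (n - 1) ≠ 0

/-- `e` is a cyclic vector for `T`. -/
def IsCyclicVector (T : H →L[ℂ] H) (e : H) : Prop :=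
  (Submodule.span ℂ (Set.range fun k : ℕ => (T ^ k) e)).topologicalClosure = ⊤

/-- `μ` is the `n`-tuple of `T` and the vector `e`:
`μ̂_i(k) = conj (μ̂_i(-k)) = ⟨Δ⁽ⁱ⁾ e, T^k e⟩` for `k ≥ 0`, the inner product being linear in its
first entry. (Mathlib's `inner ℂ x y` is linear in `y`.) -/
def IsTupleOf {n : ℕ} (T : H →L[ℂ] H) (e : H) (μ : Fin n → Distribution) : Prop :=
  ∀ (i : Fin n) (k : ℕ),
    (μ i).coeff k = inner ℂ ((T ^ k) e) (defect T i e) ∧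
    conj ((μ i).coeff (-(k : ℤ))) = inner ℂ ((T ^ k) e) (defect T i e)

/-- `J` exhibits the Hilbert space `H` as the completion `D_μ` of the analytic test functions
(modulo those of norm zero) for the norm `‖·‖_μ`, with `T` corresponding to the operator that
`f ↦ z f` induces on `D_μ`, and `e` to the constant function `1`. -/
structure IsModelMap {n : ℕ} (μ : Fin n → Distribution) (T : H →L[ℂ] H) (e : H)
    (J : AnalyticTest →ₗ[ℂ] H) : Prop where
  norm_sq : ∀ f : AnalyticTest, ((‖J f‖ ^ 2 : ℝ) : ℂ) = tupleForm μ f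
  dense : DenseRange J
  map_mulZ : ∀ f : AnalyticTest, J f.mulZ = T (J f)
  map_one : J AnalyticTest.one = e

end Operators

/-- The operator `∏_{j = a}^{b} (D + j)` on distributions. -/
def prodAbsDeriv (a b : ℤ) : Distribution →ₗ[ℂ] Distribution :=
  Polynomial.aeval absDeriv
    (∏ j ∈ Finset.Icc a b, (Polynomial.X + Polynomial.C (j : ℂ)))

end HigherDirichlet
end

/-!
Writing `F = p + (z - λ)^m h`, the shift multiplies the Hardy part of `F` isometrically and adds the
leading coefficient of `p` to `z h` as a constant term, so
`⟨T F, T G⟩ = ⟨F, G⟩ + conj (p_{m-1}) q_{m-1}`. For `F = z^{a+k}` and `G = z^a` the coefficients are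
those of a truncated Taylor expansion at `λ`, and the correction is
`λ̄^k (a+k choose m-1) (a choose m-1)`. Expanding this polynomial in `a` in the basis of binomial
coefficients (Vandermonde) reads off the numbers `⟨Δ⁽ⁱ⁾ 1, T^k 1⟩`: they vanish for `i ≥ 2m`, and
for `1 ≤ i < 2m` they are the Fourier coefficients of the distributions in the theorem.

Conversely, for any operator with `Δ⁽ⁿ⁾ = 0` Newton's formula recovers the Gram matrix of the orbit
of `e` from the tuple,
`⟨T^a e, T^b e⟩ = ∑_{i < n} (min a b choose i) μ̂_i(b - a)`.
Integrating the double series of `|f⁽ⁱ⁾|² P_{μ_i}` termwise in polar coordinates turns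
`D_{μ_i,i}(f)` into the form with exactly this kernel, so `f ↦ f(T) e` maps the analytic test
functions isometrically onto a dense subspace when `e` is cyclic.
-/

noncomputable section

namespace HigherDirichlet

open MeasureTheory

/-! ### Fourier series on the circle -/

theorem hasSum_fourier_of_summable {g : ℝ → ℂ} (hg : Continuous g)
    (hp : Function.Periodic g (2 * Real.pi)) {c : ℤ → ℂ}
    (hc : ∀ k : ℤ, c k = (2 * Real.pi : ℂ)⁻¹ * ∫ t in (0 : ℝ)..2 * Real.pi,
      g t * ((Circle.exp t ^ (-k) : Circle) : ℂ))
    (hs : Summable c) (t : ℝ) :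
    HasSum (fun k : ℤ => c k * ((Circle.exp t ^ k : Circle) : ℂ)) (g t) := by
  have : Fact (0 < 2 * Real.pi) := ⟨by positivity⟩
  have hfourier (k : ℤ) (x : ℝ) : fourier k (x : AddCircle (2 * Real.pi)) =
      ((Circle.exp x ^ k : Circle) : ℂ) := by
    rw [fourier_coe_apply, Circle.coe_zpow, Circle.coe_exp, ← Complex.exp_int_mul]
    congr 1
    push_cast
    field_simp
  let G : C(AddCircle (2 * Real.pi), ℂ) := ⟨hp.lift, continuous_coinduced_dom.mpr hg⟩
  have hG (x : ℝ) : G (x : AddCircle (2 * Real.pi)) = g x := hp.lift_coe x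
  have hcoeff : fourierCoeff G = c := by
    ext k
    rw [fourierCoeff_eq_intervalIntegral _ k 0, hc k, zero_add, Complex.real_smul]
    congr 1
    · push_cast
      ring
    · refine intervalIntegral.integral_congr fun x _ => ?_
      simp only [hG, hfourier, smul_eq_mul, mul_comm]
  have h := has_pointwise_sum_fourier_series_of_summable (f := G) (by rwa [hcoeff]) t
  simpa only [hcoeff, hG, hfourier, smul_eq_mul] using h

namespace TestFun

theorem summable_norm_coeff_mul (f : TestFun) (N : ℕ) :
    Summable fun k : ℤ => ‖f.coeff k‖ * (1 + |(k : ℝ)|) ^ N := by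
  obtain ⟨M, hM⟩ := f.exists_bound (N + 2)
  refine Summable.of_nonneg_of_le (fun k => by positivity) (fun k => ?_)
    (summable_inv_sq.mul_left (2 ^ (N + 2) * M))
  rw [← div_eq_mul_inv, le_div_iff₀ (by positivity), mul_assoc, ← pow_add]
  exact f.decay (N + 2) M hM k

theorem periodic_iteratedDeriv (f : TestFun) (j : ℕ) :
    Function.Periodic (iteratedDeriv j f.lift) (2 * Real.pi) := by
  induction j with
  | zero => simpa using f.lift_periodic
  | succ j ih =>
    intro t
    rw [iteratedDeriv_succ, ← deriv_comp_add_const, funext ih]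

theorem norm_mul_I_pow_mul_le (c : ℂ) (k : ℤ) {j N : ℕ} (hj : j ≤ N) :
    ‖(k * Complex.I) ^ j * c‖ ≤ ‖c‖ * (1 + |(k : ℝ)|) ^ N := by
  have hk : (0 : ℝ) ≤ |(k : ℝ)| := abs_nonneg _
  rw [norm_mul, norm_pow, norm_mul, Complex.norm_I, mul_one, Complex.norm_intCast, mul_comm]
  gcongr
  calc |(k : ℝ)| ^ j ≤ (1 + |(k : ℝ)|) ^ j := by gcongr; linarith
    _ ≤ (1 + |(k : ℝ)|) ^ N := pow_le_pow_right₀ (by linarith) hj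

theorem hasSum_iteratedDeriv (f : TestFun) (j : ℕ) (t : ℝ) :
    HasSum (fun k : ℤ => (k * Complex.I) ^ j * f.coeff k * ((Circle.exp t ^ k : Circle) : ℂ))
      (iteratedDeriv j f.lift t) := by
  refine hasSum_fourier_of_summable
    (f.contDiff_lift.continuous_iteratedDeriv j (by exact_mod_cast le_top))
    (f.periodic_iteratedDeriv j) (fun k => ?_) ?_ t
  · rw [integral_iteratedDeriv_mul j f.contDiff_lift f.lift_periodic k, TestFun.coeff]
    ring
  · exact .of_norm_bounded (f.summable_norm_coeff_mul j) fun k => norm_mul_I_pow_mul_le _ k le_rfl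

theorem iteratedDeriv_sum_smul_monomial (c : ℤ → ℂ) (s : Finset ℤ) (j : ℕ) (t : ℝ) :
    iteratedDeriv j (TestFun.lift (∑ k ∈ s, c k • monomial k)) t =
      ∑ k ∈ s, (k * Complex.I) ^ j * c k * ((Circle.exp t ^ k : Circle) : ℂ) := by
  induction j generalizing t with
  | zero => simp [TestFun.lift, monomial, Finset.sum_apply]
  | succ j ih =>
    rw [iteratedDeriv_succ, funext ih]
    have h := HasDerivAt.fun_sum (u := s) (x := t) fun (k : ℤ) _ =>
      (hasDerivAt_exp_zpow k t).const_mul ((k * Complex.I) ^ j * c k)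
    rw [h.deriv]
    exact Finset.sum_congr rfl fun k _ => by ring

theorem norm_iteratedDeriv_sub_sum_le (f : TestFun) {j N : ℕ} (hj : j ≤ N) (s : Finset ℤ)
    (t : ℝ) :
    ‖iteratedDeriv j (TestFun.lift (f - ∑ k ∈ s, f.coeff k • monomial k)) t‖ ≤
      ∑' k : { k // k ∉ s }, ‖f.coeff k‖ * (1 + |((k : ℤ) : ℝ)|) ^ N := by
  have hsmooth (g : TestFun) : ContDiffAt ℝ j g.lift t :=
    (g.contDiff_lift.of_le (by exact_mod_cast le_top)).contDiffAt
  have htail : HasSum (fun k : { k // k ∉ s } =>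
      ((k : ℤ) * Complex.I) ^ j * f.coeff k * ((Circle.exp t ^ (k : ℤ) : Circle) : ℂ))
      (iteratedDeriv j (TestFun.lift (f - ∑ k ∈ s, f.coeff k • monomial k)) t) := by
    rw [s.hasSum_compl_iff (f := fun k : ℤ =>
        (k * Complex.I) ^ j * f.coeff k * ((Circle.exp t ^ k : Circle) : ℂ)),
      show TestFun.lift (f - ∑ k ∈ s, f.coeff k • monomial k) =
        f.lift - TestFun.lift (∑ k ∈ s, f.coeff k • monomial k) from rfl,
      iteratedDeriv_sub (hsmooth _) (hsmooth _), iteratedDeriv_sum_smul_monomial, sub_add_cancel]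
    exact f.hasSum_iteratedDeriv j t
  rw [← htail.tsum_eq]
  refine tsum_of_norm_bounded ((f.summable_norm_coeff_mul N).subtype _).hasSum fun k => ?_
  rw [norm_mul, Circle.norm_coe, mul_one]
  exact norm_mul_I_pow_mul_le _ _ hj

end TestFun

namespace Distribution

theorem hasSum_coeff_mul_coeff (μ : Distribution) (f : TestFun) :
    HasSum (fun k : ℤ => f.coeff k * μ.coeff (-k)) ((μ : Module.Dual ℂ TestFun) f) := by
  obtain ⟨N, C, hC⟩ := μ.2
  have htail := (tendsto_tsum_compl_atTop_zero
    fun k : ℤ => ‖f.coeff k‖ * (1 + |(k : ℝ)|) ^ N).const_mul C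
  rw [mul_zero] at htail
  refine tendsto_iff_norm_sub_tendsto_zero.2
    (squeeze_zero (fun _ => norm_nonneg _) (fun s => ?_) htail)
  have hpartial : (μ : Module.Dual ℂ TestFun) (∑ k ∈ s, f.coeff k • monomial k) =
      ∑ k ∈ s, f.coeff k * μ.coeff (-k) := by
    simp [Distribution.coeff]
  rw [← hpartial, norm_sub_rev, ← map_sub]
  exact hC _ _ fun j hj t => f.norm_iteratedDeriv_sub_sum_le hj s t

theorem ext_coeff {μ ν : Distribution} (h : ∀ k, μ.coeff k = ν.coeff k) : μ = ν := by
  refine Subtype.ext (LinearMap.ext fun f => (μ.hasSum_coeff_mul_coeff f).unique ?_)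
  simpa only [h] using ν.hasSum_coeff_mul_coeff f

/-! ### Coefficients and orders of explicit distributions -/

theorem coeff_smul (c : ℂ) (μ : Distribution) (k : ℤ) : (c • μ).coeff k = c * μ.coeff k := rfl

theorem coeff_add (μ ν : Distribution) (k : ℤ) : (μ + ν).coeff k = μ.coeff k + ν.coeff k := rfl

theorem hasOrder_of_norm_coeff_bounds {μ : Distribution} {N : ℕ} {c C : ℝ} (hc : 0 < c)
    (hlower : ∀ k : ℕ, c * (1 + k : ℝ) ^ N ≤ ‖μ.coeff k‖)
    (hupper : ∀ k : ℤ, ‖μ.coeff k‖ ≤ C * (1 + |(k : ℝ)|) ^ N) : μ.HasOrder N := by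
  refine ⟨⟨C, hupper⟩, fun n ⟨B, hB⟩ => ?_⟩
  by_contra! hlt
  have hlinear (k : ℕ) : c * (1 + k : ℝ) ≤ B := by
    have hk : (0 : ℝ) < (1 + k : ℝ) ^ n := by positivity
    refine le_of_mul_le_mul_right ?_ hk
    calc c * (1 + k : ℝ) * (1 + k : ℝ) ^ n = c * (1 + k : ℝ) ^ (n + 1) := by ring
      _ ≤ c * (1 + k : ℝ) ^ N := by gcongr <;> [linarith [k.cast_nonneg (α := ℝ)]; exact hlt]
      _ ≤ B * (1 + k : ℝ) ^ n := (hlower k).trans (by simpa using hB k)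
  obtain ⟨k, hk⟩ := exists_nat_gt (B / c)
  rw [div_lt_iff₀ hc] at hk
  linarith [hlinear k]

end Distribution

theorem coeff_dirac (lam : Circle) (k : ℤ) :
    (dirac lam).coeff k = ((lam ^ (-k) : Circle) : ℂ) := rfl

theorem coeff_lebesgue (k : ℤ) : lebesgue.coeff k = if k = 0 then 1 else 0 := by
  change (monomial (-k)).coeff 0 = _
  simp only [coeff_monomial, zero_eq_neg]

theorem coeff_aeval_absDeriv (P : Polynomial ℂ) (μ : Distribution) (k : ℤ) :
    (Polynomial.aeval absDeriv P μ).coeff k = P.eval ((|k| : ℤ) : ℂ) * μ.coeff k := by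
  induction P using Polynomial.induction_on' with
  | add p q hp hq =>
    rw [map_add, LinearMap.add_apply, Distribution.coeff_add, hp, hq, Polynomial.eval_add, add_mul]
  | monomial n a =>
    rw [Polynomial.aeval_monomial, Module.End.mul_apply, Module.algebraMap_end_apply,
      Distribution.coeff_smul, Polynomial.eval_monomial, mul_assoc]
    congr 1
    induction n with
    | zero => simp
    | succ n ih => rw [pow_succ', Module.End.mul_apply, coeff_absDeriv, ih, pow_succ]; ring

theorem coeff_prodAbsDeriv (a b : ℤ) (μ : Distribution) (k : ℤ) :
    (prodAbsDeriv a b μ).coeff k =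
      (∏ j ∈ Finset.Icc a b, (((|k| : ℤ) : ℂ) + (j : ℂ))) * μ.coeff k := by
  rw [prodAbsDeriv, coeff_aeval_absDeriv, Polynomial.eval_prod]
  simp

theorem prod_Icc_add_eq_descFactorial {R : Type*} [CommRing R] (n : ℕ) {q N : ℕ} (hN : N ≤ q) :
    ∏ j ∈ Finset.Icc ((q : ℤ) + 1 - N) q, ((n : R) + (j : R)) = ((n + q).descFactorial N : R) := by
  induction N with
  | zero => simp
  | succ N ih =>
    have hIcc : Finset.Icc ((q : ℤ) + 1 - (N + 1 : ℕ)) q =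
        insert ((q : ℤ) - N) (Finset.Icc ((q : ℤ) + 1 - N) q) := by
      ext x
      simp only [Finset.mem_insert, Finset.mem_Icc]
      omega
    rw [hIcc, Finset.prod_insert (by simp), ih (by omega), Nat.descFactorial_succ,
      Nat.cast_mul, Nat.cast_sub (by omega)]
    push_cast
    ring

/-- The `i`-th distribution of the explicit tuple (for `1 ≤ i < 2m`); its Fourier coefficients
`C(i-1, m-1) C(|k|+m-1, 2m-1-i) λ̄ᵏ` are computed in `coeff_localDistribution`. -/
def localDistribution (m : ℕ) (lam : Circle) (i : ℕ) : Distribution :=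
  ((Nat.choose (i - 1) (m - 1) : ℂ) / (Nat.factorial (2 * m - 1 - i) : ℂ)) •
    prodAbsDeriv ((i : ℤ) + 1 - m) ((m : ℤ) - 1) (dirac lam)

section LocalDistribution

variable {m i : ℕ} (lam : Circle)

theorem localDistribution_eq_zero (h0 : 1 ≤ i) (hi : i ≤ m - 1) :
    localDistribution m lam i = 0 := by
  rw [localDistribution, Nat.choose_eq_zero_of_lt (by omega), Nat.cast_zero, zero_div, zero_smul]

theorem coeff_localDistribution (h0 : 1 ≤ i) (hi : i < 2 * m) (k : ℤ) :
    (localDistribution m lam i).coeff k =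
      ((Nat.choose (i - 1) (m - 1) * Nat.choose (k.natAbs + (m - 1)) (2 * m - 1 - i) : ℕ) : ℂ) *
        ((lam ^ (-k) : Circle) : ℂ) := by
  rcases lt_or_ge i m with him | hmi
  · rw [localDistribution_eq_zero lam h0 (by omega), Nat.choose_eq_zero_of_lt (by omega)]
    simp [Distribution.coeff]
  · have hprod := prod_Icc_add_eq_descFactorial (R := ℂ) k.natAbs
      (show 2 * m - 1 - i ≤ m - 1 by omega)
    rw [show ((m - 1 : ℕ) : ℤ) + 1 - ((2 * m - 1 - i : ℕ) : ℤ) = (i : ℤ) + 1 - m by omega,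
      show ((m - 1 : ℕ) : ℤ) = (m : ℤ) - 1 by omega,
      Nat.descFactorial_eq_factorial_mul_choose] at hprod
    rw [localDistribution, Distribution.coeff_smul, coeff_prodAbsDeriv, coeff_dirac,
      ← Nat.cast_natAbs, hprod]
    have := Nat.factorial_ne_zero (2 * m - 1 - i)
    push_cast
    field_simp

theorem localDistribution_last (hm : 1 ≤ m) :
    localDistribution m lam (2 * m - 1) =
      (Nat.choose (2 * m - 2) (m - 1) : ℂ) • dirac lam := by
  refine Distribution.ext_coeff fun k => ?_
  rw [coeff_localDistribution lam (by omega) (by omega), Distribution.coeff_smul, coeff_dirac,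
    show 2 * m - 1 - 1 = 2 * m - 2 by omega]
  simp

theorem choose_add_pred_le (hm : 1 ≤ m) (k N : ℕ) :
    (k + (m - 1)).choose N ≤ m ^ N * (1 + k) ^ N := by
  have hk : k ≤ m * k := Nat.le_mul_of_pos_left k hm
  calc (k + (m - 1)).choose N ≤ (k + (m - 1)) ^ N := Nat.choose_le_pow _ _
    _ ≤ (m * (1 + k)) ^ N := Nat.pow_le_pow_left (by rw [mul_add]; omega) N
    _ = m ^ N * (1 + k) ^ N := mul_pow _ _ _

theorem one_add_pow_le_factorial_mul_choose {N : ℕ} (hN : N < m) (k : ℕ) :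
    (1 + k) ^ N ≤ N ! * (k + (m - 1)).choose N :=
  calc (1 + k) ^ N ≤ (k + (m - 1) + 1 - N) ^ N := Nat.pow_le_pow_left (by omega) N
    _ ≤ (k + (m - 1)).descFactorial N := Nat.pow_sub_le_descFactorial _ _
    _ = N ! * (k + (m - 1)).choose N := Nat.descFactorial_eq_factorial_mul_choose _ _

theorem hasOrder_localDistribution (h0 : m ≤ i) (hi : i < 2 * m) :
    (localDistribution m lam i).HasOrder (2 * m - 1 - i) := by
  set N := 2 * m - 1 - i
  set c := Nat.choose (i - 1) (m - 1)
  have hc : 1 ≤ c := Nat.choose_pos (by omega)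
  have hnorm (k : ℤ) : ‖(localDistribution m lam i).coeff k‖ =
      ((c * (k.natAbs + (m - 1)).choose N : ℕ) : ℝ) := by
    rw [coeff_localDistribution lam (by omega) hi, norm_mul, Circle.norm_coe, mul_one,
      Complex.norm_natCast]
  refine Distribution.hasOrder_of_norm_coeff_bounds (c := ((N ! : ℕ) : ℝ)⁻¹) (C := c * (m : ℝ) ^ N)
    (by positivity) (fun k => ?_) (fun k => ?_)
  · rw [hnorm, inv_mul_le_iff₀ (by positivity), Int.natAbs_natCast]
    have h := (one_add_pow_le_factorial_mul_choose (show N < m by omega) k).trans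
      (Nat.mul_le_mul_left _ (Nat.le_mul_of_pos_left _ hc))
    exact_mod_cast h
  · rw [hnorm, ← Int.cast_abs, ← Nat.cast_natAbs, mul_assoc]
    have h := Nat.mul_le_mul_left c (choose_add_pred_le (show 1 ≤ m by omega) k.natAbs N)
    exact_mod_cast h

end LocalDistribution

/-! ### Newton expansions -/

theorem fwdDiff_iter_sum_choose_smul {G : Type*} [AddCommGroup G] (d : ℕ → G) (K j a : ℕ) :
    (fwdDiff 1)^[j] (fun x : ℕ => ∑ n ∈ Finset.range K, x.choose n • d n) a =
      ∑ n ∈ Finset.Ico j K, a.choose (n - j) • d n := by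
  induction j generalizing a with
  | zero => simp [Nat.Ico_zero_eq_range]
  | succ j ih =>
    rw [Function.iterate_succ_apply', fwdDiff, ih, ih, ← Finset.sum_sub_distrib]
    rcases le_or_gt K j with hKj | hjK
    · rw [Finset.Ico_eq_empty_of_le hKj, Finset.Ico_eq_empty_of_le (by omega), Finset.sum_empty,
        Finset.sum_empty]
    · rw [Finset.sum_eq_sum_Ico_succ_bot hjK, Nat.sub_self, Nat.choose_zero_right,
        Nat.choose_zero_right, sub_self, zero_add]
      refine Finset.sum_congr rfl fun n hn => ?_
      have hjn : n - j = n - (j + 1) + 1 := by have := Finset.mem_Ico.1 hn; omega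
      rw [hjn, Nat.choose_succ_succ', add_smul, add_sub_cancel_right]

theorem choose_mul_choose_add_eq_sum (q k x : ℕ) :
    x.choose q * (x + k).choose q =
      ∑ n ∈ Finset.range (2 * q + 1), x.choose n * (n.choose q * (k + q).choose (2 * q - n)) := by
  rw [show 2 * q + 1 = q + (q + 1) by ring, Finset.sum_range_add,
    Finset.sum_eq_zero fun n hn => by simp [Nat.choose_eq_zero_of_lt (Finset.mem_range.1 hn)],
    zero_add]
  rcases lt_or_ge x q with hx | hx
  · rw [Nat.choose_eq_zero_of_lt hx, zero_mul]
    refine (Finset.sum_eq_zero fun n _ => ?_).symm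
    rw [Nat.choose_eq_zero_of_lt (show x < q + n by omega), zero_mul]
  · rw [show x + k = (x - q) + (k + q) by omega, Nat.add_choose_eq,
      Finset.Nat.sum_antidiagonal_eq_sum_range_succ_mk, Finset.mul_sum]
    refine Finset.sum_congr rfl fun n _ => ?_
    have htrinomial := Nat.choose_mul (n := x) (Nat.le_add_right q n)
    rw [Nat.add_sub_cancel_left] at htrinomial
    rw [show 2 * q - (q + n) = q - n by omega, ← mul_assoc, ← htrinomial, mul_assoc]

/-! ### Defect operators -/

section Defect

variable {H : Type*} [NormedAddCommGroup H] [InnerProductSpace ℂ H] [CompleteSpace H]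
  (T : H →L[ℂ] H)

theorem inner_defect_succ (n : ℕ) (x y : H) :
    inner ℂ y (defect T (n + 1) x) =
      inner ℂ (T y) (defect T n (T x)) - inner ℂ y (defect T n x) := by
  simp [defect, ContinuousLinearMap.adjoint_inner_right]

theorem inner_defect_comm (n : ℕ) (x y : H) :
    inner ℂ y (defect T n x) = conj (inner ℂ x (defect T n y)) := by
  induction n generalizing x y with
  | zero => simp [defect]
  | succ n ih => rw [inner_defect_succ, inner_defect_succ, ih, ih x y, map_sub]

theorem fwdDiff_iter_inner_pow (x y : H) (i a : ℕ) :
    (fwdDiff 1)^[i] (fun a : ℕ => inner ℂ ((T ^ a) y) ((T ^ a) x)) a =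
      inner ℂ ((T ^ a) y) (defect T i ((T ^ a) x)) := by
  induction i generalizing a with
  | zero => simp [defect]
  | succ i ih =>
    rw [Function.iterate_succ_apply', fwdDiff, ih, ih, inner_defect_succ, pow_succ']
    rfl

theorem inner_pow_eq_sum_defect (x y : H) (a : ℕ) :
    inner ℂ ((T ^ a) y) ((T ^ a) x) =
      ∑ i ∈ Finset.range (a + 1), (a.choose i : ℂ) * inner ℂ y (defect T i x) := by
  have h := shift_eq_sum_fwdDiff_iter 1 (fun a : ℕ => inner ℂ ((T ^ a) y) ((T ^ a) x)) a 0
  simp only [fwdDiff_iter_inner_pow] at h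
  simpa using h

variable {T}

theorem defect_eq_zero_of_le {n i : ℕ} (hT : defect T n = 0) (hi : n ≤ i) : defect T i = 0 := by
  induction i, hi using Nat.le_induction with
  | base => exact hT
  | succ i _ ih => simp [defect, ih]

theorem inner_pow_eq_sum_defect_of_defect_eq_zero {n : ℕ} (hT : defect T n = 0) (x y : H) (a : ℕ) :
    inner ℂ ((T ^ a) y) ((T ^ a) x) =
      ∑ i ∈ Finset.range n, (a.choose i : ℂ) * inner ℂ y (defect T i x) := by
  rw [inner_pow_eq_sum_defect]
  rcases le_total n (a + 1) with hn | hn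
  · refine (Finset.sum_subset (Finset.range_subset_range.2 hn) fun i _ hi => ?_).symm
    rw [defect_eq_zero_of_le hT (by simpa using hi), zero_apply,
      inner_zero_right, mul_zero]
  · refine Finset.sum_subset (Finset.range_subset_range.2 hn) fun i _ hi => ?_
    rw [Nat.choose_eq_zero_of_lt (by have := Finset.mem_range.not.1 hi; omega), Nat.cast_zero,
      zero_mul]

theorem exists_norm_pow_le_of_defect_eq_zero {n : ℕ} (hT : defect T n = 0) (x : H) :
    ∃ C : ℝ, ∀ a : ℕ, ‖(T ^ a) x‖ ≤ C * (1 + a) ^ n := by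
  set S := ∑ i ∈ Finset.range n, ‖inner ℂ x (defect T i x)‖
  have : 0 ≤ S := Finset.sum_nonneg fun i _ => norm_nonneg _
  refine ⟨S + 1, fun a => ?_⟩
  have ha : (1 : ℝ) ≤ 1 + a := by linarith [a.cast_nonneg (α := ℝ)]
  have hchoose (i : ℕ) (hi : i ∈ Finset.range n) : (a.choose i : ℝ) ≤ (1 + a) ^ n :=
    calc (a.choose i : ℝ) ≤ (a : ℝ) ^ i := by exact_mod_cast Nat.choose_le_pow a i
      _ ≤ (1 + a) ^ i := by gcongr; linarith
      _ ≤ (1 + a) ^ n := pow_le_pow_right₀ ha (Finset.mem_range.1 hi).le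
  have hsq : ‖(T ^ a) x‖ ^ 2 ≤ S * (1 + a) ^ n :=
    calc ‖(T ^ a) x‖ ^ 2 = ‖(inner ℂ ((T ^ a) x) ((T ^ a) x) : ℂ)‖ := by
          rw [inner_self_eq_norm_sq_to_K, norm_pow, RCLike.norm_ofReal, abs_norm]
      _ ≤ ∑ i ∈ Finset.range n, ‖(a.choose i : ℂ) * inner ℂ x (defect T i x)‖ := by
          rw [inner_pow_eq_sum_defect_of_defect_eq_zero hT]
          exact norm_sum_le _ _
      _ ≤ ∑ i ∈ Finset.range n, (1 + (a : ℝ)) ^ n * ‖inner ℂ x (defect T i x)‖ := by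
          refine Finset.sum_le_sum fun i hi => ?_
          rw [norm_mul, Complex.norm_natCast]
          exact mul_le_mul_of_nonneg_right (hchoose i hi) (norm_nonneg _)
      _ = S * (1 + a) ^ n := by rw [← Finset.mul_sum, mul_comm]
  refine le_of_sq_le_sq (hsq.trans ?_) (by positivity)
  nlinarith [one_le_pow₀ (n := n) ha]

end Defect

theorem eq_zero_of_isCyclicVector {H : Type*} [NormedAddCommGroup H] [InnerProductSpace ℂ H]
    {T A : H →L[ℂ] H} {e : H} (he : IsCyclicVector T e)
    (h : ∀ a b : ℕ, inner ℂ ((T ^ b) e) (A ((T ^ a) e)) = 0) : A = 0 := by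
  have hdense : Dense (Submodule.span ℂ (Set.range fun k : ℕ => (T ^ k) e) : Set H) :=
    Submodule.dense_iff_topologicalClosure_eq_top.2 he
  refine ContinuousLinearMap.ext_on hdense ?_
  rintro _ ⟨a, rfl⟩
  refine hdense.eq_zero_of_inner_right (𝕜 := ℂ) fun v hv => ?_
  induction hv using Submodule.span_induction with
  | mem x hx => obtain ⟨b, rfl⟩ := hx; exact h a b
  | zero => simp
  | add x y _ _ hx hy => rw [inner_add_left, hx, hy, add_zero]
  | smul c x _ hx => rw [inner_smul_left, hx, mul_zero]

/-! ### Polynomials and cyclic vectors -/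

theorem coeff_modByMonic_X_sub_C_pow {R : Type*} [CommRing R] (r : R) (n : ℕ) (P : Polynomial R) :
    (P %ₘ (Polynomial.X - Polynomial.C r) ^ (n + 1)).coeff n =
      (Polynomial.hasseDeriv n P).eval r := by
  nontriviality R
  have hmonic := (Polynomial.monic_X_sub_C r).pow (n + 1)
  set Q := P %ₘ (Polynomial.X - Polynomial.C r) ^ (n + 1)
  have hdeg : Q.natDegree ≤ n := by
    have h := Polynomial.degree_modByMonic_lt P hmonic
    rw [Polynomial.degree_eq_natDegree hmonic.ne_zero, (Polynomial.monic_X_sub_C r).natDegree_pow,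
      Polynomial.natDegree_X_sub_C, mul_one] at h
    exact Polynomial.natDegree_le_iff_degree_le.2 (Order.lt_succ_iff.1 h)
  have htaylor : (Polynomial.taylor r P).coeff n = (Polynomial.taylor r Q).coeff n := by
    conv_lhs => rw [← Polynomial.modByMonic_add_div P ((Polynomial.X - Polynomial.C r) ^ (n + 1))]
    simp [Polynomial.taylor_mul, Polynomial.taylor_pow, Polynomial.coeff_X_pow_mul', Q]
  rw [← Polynomial.taylor_coeff, htaylor]
  rcases hdeg.eq_or_lt with heq | hlt
  · have hlead := Polynomial.coeff_taylor_natDegree r Q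
    rw [heq] at hlead
    rw [hlead, Polynomial.leadingCoeff, heq]
  · rw [Polynomial.coeff_eq_zero_of_natDegree_lt hlt,
      Polynomial.coeff_eq_zero_of_natDegree_lt ((Polynomial.natDegree_taylor Q r).trans_lt hlt)]

theorem isCyclicVector_iff_denseRange_aeval {H : Type*} [NormedAddCommGroup H]
    [InnerProductSpace ℂ H] {T : H →L[ℂ] H} {e : H} :
    IsCyclicVector T e ↔ DenseRange fun P : Polynomial ℂ => Polynomial.aeval T P e := by
  have hspan : (Submodule.span ℂ (Set.range fun k : ℕ => (T ^ k) e) : Set H) =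
      Set.range fun P : Polynomial ℂ => Polynomial.aeval T P e := by
    refine Set.Subset.antisymm (fun x hx => ?_) ?_
    · induction hx using Submodule.span_induction with
      | mem x hx => obtain ⟨k, rfl⟩ := hx; exact ⟨Polynomial.X ^ k, by simp⟩
      | zero => exact ⟨0, by simp⟩
      | add x y _ _ hx hy =>
        obtain ⟨P, rfl⟩ := hx
        obtain ⟨Q, rfl⟩ := hy
        exact ⟨P + Q, by simp⟩
      | smul c x _ hx => obtain ⟨P, rfl⟩ := hx; exact ⟨c • P, by simp⟩
    · rintro _ ⟨P, rfl⟩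
      simp only [Polynomial.aeval_eq_sum_range, sum_apply, smul_apply]
      exact Submodule.sum_mem _ fun k _ => Submodule.smul_mem _ _ (Submodule.subset_span ⟨k, rfl⟩)
  rw [IsCyclicVector, ← Submodule.dense_iff_topologicalClosure_eq_top, hspan, DenseRange]

/-! ### The shift on the Hardy space -/

namespace H2

theorem eq_of_eval_eq {f g : H2} (h : ∀ z : ℂ, ‖z‖ < 1 → f.eval z = g.eval z) : f = g := by
  refine sub_eq_zero.1 (eq_zero_of_eval _ fun z hz => ?_)
  rw [sub_eq_add_neg, ← neg_one_smul ℂ g, eval_add _ _ z hz, eval_smul _ _ z hz, h z hz,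
    neg_one_mul, add_neg_cancel]

theorem mulZ_apply_zero (f : H2) : mulZ f 0 = 0 := rfl

theorem mulZ_apply_succ (f : H2) (n : ℕ) : mulZ f (n + 1) = f n := rfl

theorem inner_mulZ_add_const (f g : H2) (c d : ℂ) :
    inner ℂ (mulZ f + const c) (mulZ g + const d) = inner ℂ f g + conj c * d := by
  rw [lp.inner_eq_tsum, lp.inner_eq_tsum,
    (lp.summable_inner (𝕜 := ℂ) (mulZ f + const c) (mulZ g + const d)).tsum_eq_zero_add]
  simp [mulZ_apply_zero, mulZ_apply_succ, const, add_comm, mul_comm]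

theorem const_zero : const 0 = 0 := by simp [const]

/-- Multiplication by `z` on `H²` as a linear isometry, the unilateral shift. -/
def mulZIsometry : H2 →ₗᵢ[ℂ] H2 :=
  LinearMap.isometryOfInner
    { toFun := mulZ
      map_add' := fun f g => by
        ext n
        cases n
        · exact (add_zero 0).symm
        · rfl
      map_smul' := fun c f => by
        ext n
        cases n
        · exact (smul_zero c).symm
        · rfl }
    fun f g => by simpa [const_zero] using inner_mulZ_add_const f g 0 0

/-- Multiplication by `z` on `H²` as a bounded operator. -/
abbrev mulZL : H2 →L[ℂ] H2 := mulZIsometry.toContinuousLinearMap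

theorem inner_mulZ (f g : H2) : inner ℂ (mulZ f) (mulZ g) = inner ℂ f g :=
  mulZIsometry.inner_map_map f g

theorem inner_mulZ_const (f : H2) (c : ℂ) : inner ℂ (mulZ f) (const c) = 0 := by
  have hzero : mulZ 0 = 0 := map_zero mulZIsometry
  simpa [const_zero, hzero] using inner_mulZ_add_const f 0 0 c

theorem eval_aeval_mulZL (P : Polynomial ℂ) (f : H2) (z : ℂ) (hz : ‖z‖ < 1) :
    (Polynomial.aeval mulZL P f).eval z = P.eval z * f.eval z := by
  induction P using Polynomial.induction_on generalizing f with
  | C a => simp [Algebra.algebraMap_eq_smul_one, eval_smul _ _ z hz]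
  | add P Q hP hQ => simp [eval_add _ _ z hz, hP, hQ, add_mul]
  | monomial n a ih =>
    rw [pow_succ, ← mul_assoc, map_mul, Polynomial.aeval_X, mul_apply_eq_comp, ih]
    change _ * (mulZ f).eval z = _
    rw [eval_mulZ _ z hz, Polynomial.eval_mul (q := Polynomial.X), Polynomial.eval_X,
      mul_assoc]

theorem isCyclicVector_mulZL : IsCyclicVector mulZL (const 1) := by
  rw [isCyclicVector_iff_denseRange_aeval]
  have hsingle (n : ℕ) (c : ℂ) : (lp.single 2 n c : H2) =
      Polynomial.aeval mulZL (Polynomial.monomial n c) (const 1) := by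
    induction n with
    | zero => simp [const, Algebra.algebraMap_eq_smul_one, ← lp.single_smul]
    | succ n ih =>
      rw [← Polynomial.X_mul_monomial, map_mul, Polynomial.aeval_X, mul_apply_eq_comp, ← ih]
      change _ = mulZ (lp.single 2 n c)
      ext k
      rcases k with _ | k
      · simp [mulZ_apply_zero]
      · simp [mulZ_apply_succ, Pi.single_apply]
  intro f
  refine mem_closure_of_tendsto (lp.hasSum_single (by norm_num) f)
    (Filter.Eventually.of_forall fun s => ⟨∑ n ∈ s, Polynomial.monomial n (f n), ?_⟩)
  simp only [map_sum, sum_apply, hsingle]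

end H2

/-! ### The shift on the local Dirichlet space -/

namespace LocalDirichlet

variable {m : ℕ} {lam : Circle}

/-- The polynomial `p` of degree `< m` is the polynomial part of `F = p + (z - λ)^m h`. -/
def IsPolynomialPart (F : LocalDirichlet m lam) (p : Polynomial ℂ) : Prop :=
  p ∈ Polynomial.degreeLT ℂ m ∧ ∀ z : ℂ, ‖z‖ < 1 →
    F.1.fst.eval z = p.eval z + (z - lam) ^ m * F.1.snd.eval z

theorem X_mul_sub_mem_degreeLT (lam : ℂ) {p : Polynomial ℂ} (hp : p ∈ Polynomial.degreeLT ℂ m) :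
    Polynomial.X * p - Polynomial.C (p.coeff (m - 1)) *
      (Polynomial.X - Polynomial.C lam) ^ m ∈ Polynomial.degreeLT ℂ m := by
  rw [Polynomial.mem_degreeLT, Polynomial.degree_lt_iff_coeff_zero] at hp ⊢
  intro n hn
  have hdeg : ((Polynomial.X - Polynomial.C lam) ^ m).natDegree = m := by
    simp [(Polynomial.monic_X_sub_C lam).natDegree_pow]
  have hlead : ((Polynomial.X - Polynomial.C lam) ^ m).coeff m = 1 := by
    simpa [hdeg] using ((Polynomial.monic_X_sub_C lam).pow m).coeff_natDegree
  rw [Polynomial.coeff_sub, Polynomial.coeff_C_mul]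
  rcases hn.eq_or_lt with rfl | hlt
  · rcases m with _ | m
    · simp [hp 0 le_rfl]
    · simp [hlead, Polynomial.coeff_X_mul]
  · rw [Polynomial.coeff_eq_zero_of_natDegree_lt (hdeg.trans_lt hlt), mul_zero, sub_zero,
      ← Nat.sub_add_cancel (Nat.one_le_of_lt hlt), Polynomial.coeff_X_mul, hp (n - 1) (by omega)]

theorem snd_eq_of_eval_eq {F : LocalDirichlet m lam} {p : Polynomial ℂ} {h : H2}
    (hp : p ∈ Polynomial.degreeLT ℂ m)
    (hF : ∀ z : ℂ, ‖z‖ < 1 → eval F z = p.eval z + (z - lam) ^ m * h.eval z) : F.1.snd = h := by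
  let G : LocalDirichlet m lam := ⟨WithLp.toLp 2 (F.1.fst, h), p, hp, hF⟩
  have hG : F = G := eval_injective _ _ fun z _ => rfl
  exact congrArg (fun G : LocalDirichlet m lam => G.1.snd) hG

theorem fst_shift (F : LocalDirichlet m lam) : (shift m lam F).1.fst = H2.mulZ F.1.fst :=
  H2.eq_of_eval_eq fun z hz => (eval_shift m lam F z hz).trans (H2.eval_mulZ _ z hz).symm

/-- In `z (p + (z - λ)^m h)` the leading term of `z p` overflows into the constant term of the
new `h`. -/
theorem snd_shift {F : LocalDirichlet m lam} {p : Polynomial ℂ} (hF : IsPolynomialPart F p) :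
    (shift m lam F).1.snd = H2.mulZ F.1.snd + H2.const (p.coeff (m - 1)) := by
  refine snd_eq_of_eval_eq (X_mul_sub_mem_degreeLT (lam : ℂ) hF.1) fun z hz => ?_
  rw [eval_shift m lam F z hz, eval, hF.2 z hz, H2.eval_add _ _ z hz, H2.eval_mulZ _ z hz,
    H2.eval_const]
  simp only [Polynomial.eval_sub, Polynomial.eval_mul, Polynomial.eval_pow, Polynomial.eval_X,
    Polynomial.eval_C]
  ring

theorem inner_def (F G : LocalDirichlet m lam) :
    inner ℂ F G = inner ℂ F.1.fst G.1.fst + inner ℂ F.1.snd G.1.snd := rfl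

theorem inner_shift {F G : LocalDirichlet m lam} {p q : Polynomial ℂ} (hF : IsPolynomialPart F p)
    (hG : IsPolynomialPart G q) : inner ℂ (shift m lam F) (shift m lam G) =
      inner ℂ F G + conj (p.coeff (m - 1)) * q.coeff (m - 1) := by
  rw [inner_def, inner_def, fst_shift, fst_shift, snd_shift hF, snd_shift hG, H2.inner_mulZ,
    H2.inner_mulZ_add_const, add_assoc]

variable (m lam) in
theorem isExpansive_shift : IsExpansive (shift m lam) := by
  intro F
  obtain ⟨p, hp⟩ := F.2
  have hsq : ‖shift m lam F‖ ^ 2 = ‖F‖ ^ 2 + ‖p.coeff (m - 1)‖ ^ 2 := by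
    have h := inner_shift hp hp
    have hself (G : LocalDirichlet m lam) : inner ℂ G G = (‖G‖ : ℂ) ^ 2 :=
      inner_self_eq_norm_sq_to_K G
    rw [hself, hself, Complex.conj_mul'] at h
    exact_mod_cast h
  exact le_of_sq_le_sq (by rw [hsq]; linarith [sq_nonneg ‖p.coeff (m - 1)‖]) (norm_nonneg _)

theorem eval_aeval_shift (P : Polynomial ℂ) (F : LocalDirichlet m lam) (z : ℂ) (hz : ‖z‖ < 1) :
    eval (Polynomial.aeval (shift m lam) P F) z = P.eval z * eval F z := by
  induction P using Polynomial.induction_on generalizing F with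
  | C a => simp [Algebra.algebraMap_eq_smul_one, eval_smul _ _ z hz]
  | add P Q hP hQ => simp [eval_add _ _ z hz, hP, hQ, add_mul]
  | monomial n a ih =>
    rw [pow_succ, ← mul_assoc, map_mul, Polynomial.aeval_X, mul_apply_eq_comp, ih,
      eval_shift m lam F z hz, Polynomial.eval_mul (q := Polynomial.X), Polynomial.eval_X,
      mul_assoc]

/-- The element `(z - λ)^m h` of the local Dirichlet space. -/
def ofHardy (m : ℕ) (lam : Circle) (h : H2) : LocalDirichlet m lam :=
  ⟨WithLp.toLp 2 (Polynomial.aeval H2.mulZL ((Polynomial.X - Polynomial.C (lam : ℂ)) ^ m) h, h), 0,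
    Submodule.zero_mem _, fun z hz => by
      refine (H2.eval_aeval_mulZL _ h z hz).trans ?_
      rw [Polynomial.eval_zero, zero_add, Polynomial.eval_pow, Polynomial.eval_sub,
        Polynomial.eval_X, Polynomial.eval_C]
      rfl⟩

theorem eval_ofHardy (h : H2) (z : ℂ) (hz : ‖z‖ < 1) :
    eval (ofHardy m lam h) z = (z - lam) ^ m * h.eval z := by
  refine (H2.eval_aeval_mulZL _ h z hz).trans ?_
  rw [Polynomial.eval_pow, Polynomial.eval_sub, Polynomial.eval_X, Polynomial.eval_C]

variable (m lam) in
theorem continuous_ofHardy : Continuous (ofHardy m lam) :=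
  ((WithLp.prod_continuous_toLp 2 H2 H2).comp
    ((ContinuousLinearMap.continuous _).prodMk continuous_id)).subtype_mk _

/-! ### The orbit of the constant function -/

variable (lam) (hm : 1 ≤ m)

theorem norm_one : ‖one m lam hm‖ = 1 := by
  have h : ‖one m lam hm‖ ^ 2 = 1 := by
    rw [← inner_self_eq_norm_sq (𝕜 := ℂ), inner_def]
    simp [one, H2.const]
  exact (pow_eq_one_iff_of_nonneg (norm_nonneg _) two_ne_zero).1 h

theorem eval_one (z : ℂ) : eval (one m lam hm) z = 1 := H2.eval_const 1 z

theorem eval_shift_pow_one (a : ℕ) (z : ℂ) (hz : ‖z‖ < 1) :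
    eval ((shift m lam ^ a) (one m lam hm)) z = z ^ a := by
  simpa [eval_one] using eval_aeval_shift (Polynomial.X ^ a) (one m lam hm) z hz

theorem isPolynomialPart_aeval_shift_one (P : Polynomial ℂ) :
    IsPolynomialPart (Polynomial.aeval (shift m lam) P (one m lam hm))
      (P %ₘ (Polynomial.X - Polynomial.C (lam : ℂ)) ^ m) := by
  have hmem : P %ₘ (Polynomial.X - Polynomial.C (lam : ℂ)) ^ m ∈ Polynomial.degreeLT ℂ m := by
    simpa [Polynomial.mem_degreeLT, Polynomial.degree_pow] using
      Polynomial.degree_modByMonic_lt P ((Polynomial.monic_X_sub_C (lam : ℂ)).pow m)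
  set F := Polynomial.aeval (shift m lam) P (one m lam hm)
  have heval (z : ℂ) (hz : ‖z‖ < 1) : eval F z =
      (P %ₘ (Polynomial.X - Polynomial.C (lam : ℂ)) ^ m).eval z + (z - lam) ^ m *
        (Polynomial.aeval H2.mulZL (P /ₘ (Polynomial.X - Polynomial.C (lam : ℂ)) ^ m)
          (H2.const 1)).eval z := by
    rw [eval_aeval_shift P _ z hz, eval_one, mul_one, H2.eval_aeval_mulZL _ _ z hz, H2.eval_const,
      mul_one]
    conv_lhs => rw [← Polynomial.modByMonic_add_div P
      ((Polynomial.X - Polynomial.C (lam : ℂ)) ^ m)]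
    simp only [Polynomial.eval_add, Polynomial.eval_mul, Polynomial.eval_pow, Polynomial.eval_sub,
      Polynomial.eval_X, Polynomial.eval_C]
  exact ⟨hmem, by rwa [snd_eq_of_eval_eq hmem heval]⟩

theorem isCyclicVector_one : IsCyclicVector (shift m lam) (one m lam hm) := by
  rw [isCyclicVector_iff_denseRange_aeval]
  intro F
  obtain ⟨p, -, hF⟩ := F.2
  set h := F.1.snd
  have hdecomp : Polynomial.aeval (shift m lam) p (one m lam hm) + ofHardy m lam h = F :=
    eval_injective _ _ fun z hz => by
      rw [eval_add _ _ z hz, eval_aeval_shift p _ z hz, eval_one, mul_one, eval_ofHardy h z hz]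
      exact (hF z hz).symm
  rw [← hdecomp]
  refine map_mem_closure (f := fun h => _ + ofHardy m lam h)
    (continuous_const.add (continuous_ofHardy m lam))
    (isCyclicVector_iff_denseRange_aeval.1 H2.isCyclicVector_mulZL h) ?_
  rintro _ ⟨P, rfl⟩
  refine ⟨p + (Polynomial.X - Polynomial.C (lam : ℂ)) ^ m * P, eval_injective _ _ fun z hz => ?_⟩
  simp only [eval_aeval_shift _ _ z hz, eval_add _ _ z hz, eval_ofHardy _ z hz, eval_one,
    H2.eval_aeval_mulZL _ _ z hz, H2.eval_const]
  simp

theorem inner_shift_pow_one (k : ℕ) :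
    inner ℂ ((shift m lam ^ k) (one m lam hm)) (one m lam hm) = if k = 0 then 1 else 0 := by
  rcases k with _ | k
  · refine (inner_self_eq_norm_sq_to_K (𝕜 := ℂ) (one m lam hm)).trans ?_
    rw [norm_one]
    simp
  · rw [pow_succ', mul_apply_eq_comp, inner_def, fst_shift, if_neg k.succ_ne_zero]
    change inner ℂ (H2.mulZ _) (H2.const 1) + inner ℂ _ (0 : H2) = 0
    rw [H2.inner_mulZ_const, inner_zero_right, add_zero]

theorem inner_shift_pow_succ_one (k a : ℕ) :
    inner ℂ ((shift m lam ^ (a + 1)) ((shift m lam ^ k) (one m lam hm)))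
        ((shift m lam ^ (a + 1)) (one m lam hm)) =
      inner ℂ ((shift m lam ^ a) ((shift m lam ^ k) (one m lam hm)))
        ((shift m lam ^ a) (one m lam hm)) +
      conj (lam : ℂ) ^ k * (a.choose (m - 1) * (a + k).choose (m - 1) : ℕ) := by
  obtain ⟨q, rfl⟩ := Nat.exists_eq_add_of_le' hm
  have hpart (b : ℕ) := isPolynomialPart_aeval_shift_one lam hm (Polynomial.X ^ b)
  simp only [map_pow, Polynomial.aeval_X] at hpart
  have hcoeff (b : ℕ) : ((Polynomial.X ^ b : Polynomial ℂ) %ₘ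
      (Polynomial.X - Polynomial.C (lam : ℂ)) ^ (q + 1)).coeff q =
        b.choose q * (lam : ℂ) ^ (b - q) := by
    rw [coeff_modByMonic_X_sub_C_pow, ← Polynomial.monomial_one_right_eq_X_pow,
      Polynomial.hasseDeriv_monomial, Polynomial.eval_monomial, mul_one]
  rw [← mul_apply_eq_comp, ← mul_apply_eq_comp, ← pow_add, ← pow_add, add_right_comm, pow_succ',
    pow_succ' _ a, mul_apply_eq_comp, mul_apply_eq_comp, inner_shift (hpart _) (hpart _),
    Nat.add_sub_cancel, hcoeff, hcoeff]
  congr 1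
  rcases lt_or_ge a q with hlt | hle
  · simp [Nat.choose_eq_zero_of_lt hlt]
  · have hlam : conj (lam : ℂ) * lam = 1 := by
      rw [mul_comm, Complex.mul_conj, Circle.normSq_coe, Complex.ofReal_one]
    rw [show a + k - q = k + (a - q) by omega]
    simp only [map_mul, map_pow, map_natCast, pow_add, Nat.cast_mul]
    linear_combination (conj (lam : ℂ) ^ k * a.choose q * (a + k).choose q) *
      congrArg (· ^ (a - q)) hlam

/-! ### The defect operators of the shift -/

theorem inner_shift_pow_defect_succ (i k a : ℕ) :
    inner ℂ ((shift m lam ^ a) ((shift m lam ^ k) (one m lam hm)))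
        (defect (shift m lam) (i + 1) ((shift m lam ^ a) (one m lam hm))) =
      ∑ n ∈ Finset.Ico i (2 * (m - 1) + 1), a.choose (n - i) • (conj (lam : ℂ) ^ k *
        (n.choose (m - 1) * (k + (m - 1)).choose (2 * (m - 1) - n) : ℕ)) := by
  rw [← fwdDiff_iter_inner_pow, Function.iterate_succ_apply, ← fwdDiff_iter_sum_choose_smul]
  refine congrArg (fun g => (fwdDiff 1)^[i] g a) (funext fun x => ?_)
  rw [fwdDiff, inner_shift_pow_succ_one, add_sub_cancel_left, choose_mul_choose_add_eq_sum]
  simp only [nsmul_eq_mul, Nat.cast_sum, Nat.cast_mul, Finset.mul_sum]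
  exact Finset.sum_congr rfl fun n _ => by ring

theorem inner_defect_succ_one (k : ℕ) {i : ℕ} (hi : i + 1 < 2 * m) :
    inner ℂ ((shift m lam ^ k) (one m lam hm)) (defect (shift m lam) (i + 1) (one m lam hm)) =
      conj (lam : ℂ) ^ k * (i.choose (m - 1) * (k + (m - 1)).choose (2 * (m - 1) - i) : ℕ) := by
  have h := inner_shift_pow_defect_succ lam hm i k 0
  rw [Finset.sum_eq_single_of_mem i (Finset.mem_Ico.2 ⟨le_rfl, by omega⟩) fun n hn hni => ?_] at h
  · simpa using h
  · have : i < n := lt_of_le_of_ne (Finset.mem_Ico.1 hn).1 hni.symm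
    rw [Nat.choose_eq_zero_of_lt (by omega), zero_smul]

theorem defect_shift_eq_zero (hm : 1 ≤ m) : defect (shift m lam) (2 * m) = 0 := by
  have hvanish (a k : ℕ) : inner ℂ ((shift m lam ^ (a + k)) (one m lam hm))
      (defect (shift m lam) (2 * m) ((shift m lam ^ a) (one m lam hm))) = 0 := by
    rw [pow_add, mul_apply_eq_comp, show 2 * m = 2 * (m - 1) + 1 + 1 by omega,
      inner_shift_pow_defect_succ, Finset.Ico_self, Finset.sum_empty]
  refine eq_zero_of_isCyclicVector (isCyclicVector_one lam hm) fun a b => ?_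
  rcases le_total a b with h | h
  · obtain ⟨k, rfl⟩ := Nat.exists_eq_add_of_le h
    exact hvanish a k
  · obtain ⟨k, rfl⟩ := Nat.exists_eq_add_of_le h
    rw [inner_defect_comm, hvanish b k, map_zero]

theorem isStrictIsometry_shift (hm : 1 ≤ m) : IsStrictIsometry (shift m lam) (2 * m) := by
  refine ⟨defect_shift_eq_zero lam hm, fun h => ?_⟩
  have hchoose : (2 * m - 2).choose (m - 1) ≠ 0 := (Nat.choose_pos (by omega)).ne'
  have hinner := inner_defect_succ_one lam hm 0 (i := 2 * m - 2) (by omega)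
  rw [show 2 * m - 2 + 1 = 2 * m - 1 by omega, h, show 2 * (m - 1) - (2 * m - 2) = 0 by omega]
    at hinner
  exact hchoose (Nat.cast_eq_zero (R := ℂ) |>.1 (by simpa using hinner.symm))

end LocalDirichlet

/-! ### Power series with rapidly decreasing coefficients -/

/-- Power series with rapidly decreasing coefficients are the functions holomorphic on `𝔻` and
smooth up to the boundary, so this describes the Taylor coefficients of elements of `𝒟ₐ`. -/
def RapidDecay (a : ℕ → ℂ) : Prop := ∀ N : ℕ, Summable fun n : ℕ => ‖a n‖ * (1 + n : ℝ) ^ N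

theorem RapidDecay.summable_norm {a : ℕ → ℂ} (ha : RapidDecay a) : Summable fun n => ‖a n‖ := by
  simpa using ha 0

/-- The Taylor coefficients of the analytic extension of a function in `𝒟ₐ`. -/
def AnalyticTest.taylorCoeff (f : AnalyticTest) (n : ℕ) : ℂ := (f : TestFun).coeff n

theorem AnalyticTest.rapidDecay_taylorCoeff (f : AnalyticTest) :
    RapidDecay f.taylorCoeff := fun N => by
  simpa [AnalyticTest.taylorCoeff, Function.comp_def] using
    (TestFun.summable_norm_coeff_mul (f : TestFun) N).comp_injective Nat.cast_injective

/-- The power series `∑ aₙ zⁿ`, as a function of `z`. -/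
def powerSum (a : ℕ → ℂ) (z : ℂ) : ℂ := ∑' n : ℕ, a n * z ^ n

theorem AnalyticTest.extend_eq_powerSum (f : AnalyticTest) :
    f.extend = powerSum f.taylorCoeff := by
  ext z
  have h (k : ℕ) : (f : TestFun).coeff (-((k : ℤ) + 1)) = 0 := f.2 _ (by omega)
  simp only [AnalyticTest.extend, poisson, powerSum, AnalyticTest.taylorCoeff, h, zero_mul,
    tsum_zero, add_zero]

theorem summable_norm_mul_pow {a : ℕ → ℂ} (ha : Summable fun n => ‖a n‖) {z : ℂ} (hz : ‖z‖ ≤ 1) :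
    Summable fun n => ‖a n * z ^ n‖ :=
  ha.of_nonneg_of_le (fun _ => norm_nonneg _) fun n => by
    rw [norm_mul, norm_pow]
    exact mul_le_of_le_one_right (norm_nonneg _) (pow_le_one₀ (norm_nonneg _) hz)

theorem hasSum_powerSum {a : ℕ → ℂ} (ha : Summable fun n => ‖a n‖) {z : ℂ} (hz : ‖z‖ ≤ 1) :
    HasSum (fun n => a n * z ^ n) (powerSum a z) :=
  (summable_norm_mul_pow ha hz).of_norm.hasSum

/-- The Taylor coefficients of the `i`-th derivative of `∑ aₙ zⁿ`. -/
def derivCoeff (a : ℕ → ℂ) (i n : ℕ) : ℂ := (n + i).descFactorial i * a (n + i)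

theorem derivCoeff_zero (a : ℕ → ℂ) : derivCoeff a 0 = a := by
  ext n
  simp [derivCoeff]

theorem derivCoeff_derivCoeff_one (a : ℕ → ℂ) (i : ℕ) :
    derivCoeff (derivCoeff a i) 1 = derivCoeff a (i + 1) := by
  ext n
  rw [derivCoeff, derivCoeff, derivCoeff, Nat.descFactorial_one,
    show n + (i + 1) = n + 1 + i by ring, Nat.descFactorial_succ,
    show n + 1 + i - i = n + 1 by omega]
  push_cast
  ring

namespace RapidDecay

variable {a : ℕ → ℂ}

theorem rapidDecay_derivCoeff (ha : RapidDecay a) (i : ℕ) : RapidDecay (derivCoeff a i) := by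
  intro N
  refine ((summable_nat_add_iff i).2 (ha (N + i))).of_nonneg_of_le (fun n => by positivity)
    fun n => ?_
  have hdesc : ((n + i).descFactorial i : ℝ) ≤ (1 + (n + i : ℕ) : ℝ) ^ i := by
    calc ((n + i).descFactorial i : ℝ) ≤ ((n + i : ℕ) : ℝ) ^ i := by
          exact_mod_cast Nat.descFactorial_le_pow (n + i) i
      _ ≤ _ := by gcongr; linarith
  rw [derivCoeff, norm_mul, Complex.norm_natCast]
  calc ((n + i).descFactorial i : ℝ) * ‖a (n + i)‖ * (1 + n) ^ N
      ≤ (1 + (n + i : ℕ) : ℝ) ^ i * ‖a (n + i)‖ * (1 + (n + i : ℕ)) ^ N := by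
        gcongr
        omega
    _ = _ := by rw [pow_add]; ring

theorem hasDerivAt_powerSum (ha : RapidDecay a) {z : ℂ} (hz : ‖z‖ < 1) :
    HasDerivAt (powerSum a) (powerSum (derivCoeff a 1) z) z := by
  have hbd (n : ℕ) (y : ℂ) (hy : y ∈ Metric.ball (0 : ℂ) 1) :
      ‖a n * ((n : ℂ) * y ^ (n - 1))‖ ≤ ‖a n‖ * (1 + n : ℝ) ^ 1 := by
    rw [norm_mul, norm_mul, norm_pow, Complex.norm_natCast, pow_one]
    gcongr
    exact (mul_le_of_le_one_right n.cast_nonneg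
      (pow_le_one₀ (norm_nonneg _) (mem_ball_zero_iff.1 hy).le)).trans (by linarith)
  have hz' : z ∈ Metric.ball (0 : ℂ) 1 := mem_ball_zero_iff.2 hz
  have h := hasDerivAt_tsum_of_isPreconnected (g := fun (n : ℕ) (y : ℂ) => a n * y ^ n)
    (g' := fun n y => a n * ((n : ℂ) * y ^ (n - 1))) (ha 1) Metric.isOpen_ball
    (convex_ball (0 : ℂ) 1).isPreconnected
    (fun n y _ => (hasDerivAt_pow n y).const_mul (a n)) hbd hz'
    (summable_norm_mul_pow ha.summable_norm hz.le).of_norm hz'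
  rw [(Summable.of_norm_bounded (ha 1) fun n => hbd n z hz').tsum_eq_zero_add] at h
  convert! h using 1
  simp only [powerSum, derivCoeff, Nat.descFactorial_one, Nat.cast_zero, zero_mul,
    mul_zero, zero_add, Nat.add_sub_cancel]
  refine tsum_congr fun n => ?_
  push_cast
  ring

theorem iteratedDeriv_powerSum (ha : RapidDecay a) (i : ℕ) {z : ℂ} (hz : ‖z‖ < 1) :
    iteratedDeriv i (powerSum a) z = powerSum (derivCoeff a i) z := by
  induction i generalizing z with
  | zero => rw [iteratedDeriv_zero, derivCoeff_zero]
  | succ i ih =>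
    have h : iteratedDeriv i (powerSum a) =ᶠ[𝓝 z] powerSum (derivCoeff a i) := by
      filter_upwards [Metric.isOpen_ball.mem_nhds (mem_ball_zero_iff.2 hz)] with y hy
      exact ih (mem_ball_zero_iff.1 hy)
    rw [iteratedDeriv_succ, h.deriv_eq, ((ha.rapidDecay_derivCoeff i).hasDerivAt_powerSum hz).deriv,
      derivCoeff_derivCoeff_one]

end RapidDecay

/-! ### Poisson extensions -/

/-- The harmonic extension to `𝔻` of the character `ζᵏ` of the circle; one of the two exponents
is always `0`. -/
def harmonicMonomial (k : ℤ) (z : ℂ) : ℂ := z ^ k.toNat * conj z ^ (-k).toNat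

theorem norm_harmonicMonomial (k : ℤ) (z : ℂ) : ‖harmonicMonomial k z‖ = ‖z‖ ^ k.natAbs := by
  rw [harmonicMonomial, norm_mul, norm_pow, norm_pow, RCLike.norm_conj, ← pow_add]
  congr 1
  omega

theorem summable_norm_mul_pow_natAbs {c : ℤ → ℂ} {N : ℕ} {C : ℝ}
    (hc : ∀ k, ‖c k‖ ≤ C * (1 + |(k : ℝ)|) ^ N) {r : ℝ} (hr0 : 0 < r) (hr1 : r < 1) :
    Summable fun k : ℤ => ‖c k‖ * r ^ k.natAbs := by
  have h : Summable fun n : ℕ => (1 + n : ℝ) ^ N * r ^ n := by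
    have hgeom : Summable fun n : ℕ => (n : ℝ) ^ N * r ^ n :=
      summable_pow_mul_geometric_of_norm_lt_one N (by rwa [Real.norm_of_nonneg hr0.le])
    refine (((summable_nat_add_iff 1).2 hgeom).mul_left r⁻¹).congr fun n => ?_
    push_cast
    rw [pow_succ, add_comm (n : ℝ) 1]
    field_simp
  refine Summable.of_nonneg_of_le (fun k => by positivity) (fun k => ?_)
    (f := fun k : ℤ => C * ((1 + |(k : ℝ)|) ^ N * r ^ k.natAbs)) ?_
  · rw [← mul_assoc]
    gcongr
    exact hc k
  · refine Summable.mul_left C (Summable.of_nat_of_neg ?_ ?_) <;> simpa using h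

section Poisson

variable {c : ℤ → ℂ} {r : ℝ} {z : ℂ}

theorem summable_norm_mul_harmonicMonomial (hc : Summable fun k : ℤ => ‖c k‖ * r ^ k.natAbs)
    (hz : ‖z‖ ≤ r) : Summable fun k : ℤ => ‖c k * harmonicMonomial k z‖ :=
  hc.of_nonneg_of_le (fun _ => norm_nonneg _) fun k => by
    rw [norm_mul, norm_harmonicMonomial]
    gcongr

theorem hasSum_poisson (hc : Summable fun k : ℤ => ‖c k‖ * r ^ k.natAbs) (hz : ‖z‖ ≤ r) :
    HasSum (fun k : ℤ => c k * harmonicMonomial k z) (poisson c z) := by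
  have hs := (summable_norm_mul_harmonicMonomial hc hz).of_norm
  have hnonneg := (hs.comp_injective (i := fun n : ℕ => (n : ℤ)) Nat.cast_injective).hasSum
  have hneg := (hs.comp_injective (i := fun n : ℕ => -((n : ℤ) + 1))
    fun a b hab => by simpa using hab).hasSum
  convert HasSum.of_nat_of_neg_add_one (f := fun k : ℤ => c k * harmonicMonomial k z)
    hnonneg hneg using 1
  rw [poisson]
  congr 1
  · exact tsum_congr fun n => by simp [harmonicMonomial]
  · refine tsum_congr fun n => ?_
    simp only [Function.comp_apply, harmonicMonomial, show (-((n : ℤ) + 1)).toNat = 0 by omega,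
      show (-(-((n : ℤ) + 1))).toNat = n + 1 by omega, pow_zero, one_mul]

end Poisson

/-! ### Termwise integration -/

/-- The `(a, b, k)` term in the expansion of `|∑ gₙ zⁿ|² P_c(z)` into monomials in `z` and `z̄`,
for `p = ((a, b), k)`. -/
def normSqPoissonTerm (g : ℕ → ℂ) (c : ℤ → ℂ) (p : (ℕ × ℕ) × ℤ) (z : ℂ) : ℂ :=
  g p.1.1 * conj (g p.1.2) * c p.2 *
    (z ^ (p.1.1 + p.2.toNat) * conj z ^ (p.1.2 + (-p.2).toNat))

section Termwise

variable {g : ℕ → ℂ} {c : ℤ → ℂ} {r : ℝ} {z : ℂ}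

theorem normSqPoissonTerm_eq_mul (g : ℕ → ℂ) (c : ℤ → ℂ) (p : (ℕ × ℕ) × ℤ) (z : ℂ) :
    normSqPoissonTerm g c p z =
      g p.1.1 * z ^ p.1.1 * conj (g p.1.2 * z ^ p.1.2) * (c p.2 * harmonicMonomial p.2 z) := by
  simp only [normSqPoissonTerm, harmonicMonomial, map_mul, map_pow, pow_add]
  ring

theorem norm_normSqPoissonTerm_le (p : (ℕ × ℕ) × ℤ) (hr : r ≤ 1) (hz : ‖z‖ ≤ r) :
    ‖normSqPoissonTerm g c p z‖ ≤ ‖g p.1.1‖ * ‖g p.1.2‖ * (‖c p.2‖ * r ^ p.2.natAbs) := by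
  have hpow (n : ℕ) : ‖z‖ ^ n ≤ 1 := pow_le_one₀ (norm_nonneg _) (hz.trans hr)
  simp only [normSqPoissonTerm_eq_mul, norm_mul, RCLike.norm_conj, norm_pow, norm_harmonicMonomial]
  gcongr
  · exact mul_le_of_le_one_right (norm_nonneg _) (hpow _)
  · exact mul_le_of_le_one_right (norm_nonneg _) (hpow _)

theorem summable_norm_normSqPoissonTerm_bound (hg : Summable fun n => ‖g n‖) (hr : 0 ≤ r)
    (hc : Summable fun k : ℤ => ‖c k‖ * r ^ k.natAbs) :
    Summable fun p : (ℕ × ℕ) × ℤ => ‖g p.1.1‖ * ‖g p.1.2‖ * (‖c p.2‖ * r ^ p.2.natAbs) :=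
  (hg.mul_of_nonneg hg (fun _ => norm_nonneg _) fun _ => norm_nonneg _).mul_of_nonneg hc
    (fun _ => by positivity) fun _ => by positivity

theorem hasSum_normSqPoissonTerm (hg : Summable fun n => ‖g n‖)
    (hc : Summable fun k : ℤ => ‖c k‖ * r ^ k.natAbs) (hr : r ≤ 1) (hz : ‖z‖ ≤ r) :
    HasSum (fun p => normSqPoissonTerm g c p z)
      (((‖powerSum g z‖ ^ 2 : ℝ) : ℂ) * poisson c z) := by
  have hgs := summable_norm_mul_pow hg (hz.trans hr)
  have hgsum := hasSum_powerSum hg (hz.trans hr)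
  have hconj : Summable fun n => ‖conj (g n * z ^ n)‖ := by simpa only [RCLike.norm_conj] using hgs
  have hsq := hgsum.mul (hgsum.map (starRingEnd ℂ) Complex.continuous_conj)
    (hgs.mul_norm hconj).of_norm
  have h := hsq.mul (hasSum_poisson hc hz)
    ((hgs.mul_norm hconj).mul_norm (summable_norm_mul_harmonicMonomial hc hz)).of_norm
  rw [Complex.mul_conj, Complex.normSq_eq_norm_sq] at h
  simpa only [normSqPoissonTerm_eq_mul, Function.comp_apply] using h

variable {X : Type*} [MeasurableSpace X] {ν : Measure X} {ζ w : X → ℂ}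

theorem integrable_normSqPoissonTerm_mul (g : ℕ → ℂ) (c : ℤ → ℂ)
    (hζ : AEStronglyMeasurable ζ ν) (hw : Integrable w ν) (hr : r ≤ 1)
    (hb : ∀ᵐ x ∂ν, ‖ζ x‖ ≤ r) (p : (ℕ × ℕ) × ℤ) :
    Integrable (fun x => normSqPoissonTerm g c p (ζ x) * w x) ν := by
  have hcont : Continuous (normSqPoissonTerm g c p) := by
    unfold normSqPoissonTerm
    fun_prop
  exact hw.bdd_mul (hcont.comp_aestronglyMeasurable hζ)
    (hb.mono fun x hx => norm_normSqPoissonTerm_le p hr hx)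

/-- If the mixed moments of `w ν` vanish off the diagonal, only the terms with `k = b - a` of the
expansion survive integration. -/
theorem hasSum_integral_normSq_mul_poisson (hζ : AEStronglyMeasurable ζ ν) (hw : Integrable w ν)
    (hr0 : 0 ≤ r) (hr1 : r ≤ 1) (hb : ∀ᵐ x ∂ν, ‖ζ x‖ ≤ r) (hg : Summable fun n => ‖g n‖)
    (hc : Summable fun k : ℤ => ‖c k‖ * r ^ k.natAbs) {M : ℕ → ℂ}
    (hM : ∀ p q : ℕ, ∫ x, ζ x ^ p * conj (ζ x) ^ q * w x ∂ν = if p = q then M p else 0) :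
    HasSum (fun p : ℕ × ℕ => g p.1 * conj (g p.2) * c ((p.2 : ℤ) - p.1) * M (max p.1 p.2))
      (∫ x, ((‖powerSum g (ζ x)‖ ^ 2 : ℝ) : ℂ) * poisson c (ζ x) * w x ∂ν) := by
  have hint := integrable_normSqPoissonTerm_mul g c hζ hw hr1 hb
  have hsum : Summable fun p => ∫ x, ‖normSqPoissonTerm g c p (ζ x) * w x‖ ∂ν := by
    refine ((summable_norm_normSqPoissonTerm_bound hg hr0 hc).mul_right
      (∫ x, ‖w x‖ ∂ν)).of_nonneg_of_le (fun p => integral_nonneg fun x => norm_nonneg _)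
      fun p => ?_
    rw [← integral_const_mul]
    refine integral_mono_ae (hint p).norm (hw.norm.const_mul _) (hb.mono fun x hx => ?_)
    simp only [norm_mul (normSqPoissonTerm g c p (ζ x))]
    gcongr
    exact norm_normSqPoissonTerm_le p hr1 hx
  have htriple := hasSum_integral_of_summable_integral_norm hint hsum
  rw [integral_congr_ae (hb.mono fun x hx =>
    ((hasSum_normSqPoissonTerm hg hc hr1 hx).mul_right (w x)).tsum_eq)] at htriple
  simp only [normSqPoissonTerm, mul_assoc (_ * c _), integral_const_mul, hM] at htriple
  have hinj : Function.Injective fun p : ℕ × ℕ => ((p, (p.2 : ℤ) - p.1) : (ℕ × ℕ) × ℤ) :=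
    fun p q h => (Prod.ext_iff.1 h).1
  rw [← hinj.hasSum_iff] at htriple
  · refine (congrArg (HasSum · _) (funext fun p => ?_)).mpr htriple
    simp only [Function.comp_apply]
    rw [if_pos (by omega), show p.1 + ((p.2 : ℤ) - p.1).toNat = max p.1 p.2 by omega]
  · rintro ⟨⟨a, b⟩, k⟩ hk
    dsimp only
    rw [if_neg, mul_zero]
    intro h
    exact hk ⟨(a, b), by simp only [Prod.mk.injEq, true_and]; omega⟩

end Termwise

/-! ### Moments -/

theorem integral_exp_zpow (a : ℝ) (n : ℤ) :
    ∫ t in a..a + 2 * Real.pi, ((Circle.exp t ^ n : Circle) : ℂ) =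
      if n = 0 then (2 * Real.pi : ℂ) else 0 := by
  split_ifs with hn
  · subst hn
    simp
  · have hne : (n : ℂ) * Complex.I ≠ 0 := mul_ne_zero (by exact_mod_cast hn) Complex.I_ne_zero
    have h := intervalIntegral.integral_eq_sub_of_hasDerivAt (a := a) (b := a + 2 * Real.pi)
      (fun t _ => hasDerivAt_exp_zpow n t)
      ((continuous_const.mul (contDiff_exp_zpow n).continuous).intervalIntegrable _ _)
    rw [intervalIntegral.integral_const_mul] at h
    simp only [Circle.exp_add, Circle.exp_two_pi, mul_one, sub_self] at h
    exact (mul_eq_zero.1 h).resolve_left hne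

theorem polar_pow_mul_conj_pow (ρ t : ℝ) (p q : ℕ) :
    ((ρ : ℂ) * (Circle.exp t : ℂ)) ^ p * conj ((ρ : ℂ) * (Circle.exp t : ℂ)) ^ q =
      (ρ : ℂ) ^ (p + q) * ((Circle.exp t ^ ((p : ℤ) - q) : Circle) : ℂ) := by
  rw [zpow_sub, zpow_natCast, zpow_natCast, map_mul, Complex.conj_ofReal, ← Circle.coe_inv_eq_conj,
    Circle.coe_mul, Circle.coe_inv, Circle.coe_inv, Circle.coe_pow, Circle.coe_pow, mul_pow,
    mul_pow, pow_add, inv_pow]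
  ring

theorem integral_circle_moment (r : ℝ) (p q : ℕ) :
    ∫ t in Set.Ioc (0 : ℝ) (2 * Real.pi), ((r : ℂ) * (Circle.exp t : ℂ)) ^ p *
      conj ((r : ℂ) * (Circle.exp t : ℂ)) ^ q =
      if p = q then 2 * Real.pi * (r : ℂ) ^ (2 * p) else 0 := by
  have h := integral_exp_zpow 0 ((p : ℤ) - q)
  rw [zero_add, intervalIntegral.integral_of_le (by positivity)] at h
  simp only [polar_pow_mul_conj_pow]
  rw [integral_const_mul, h]
  rcases eq_or_ne p q with rfl | hpq
  · rw [sub_self, if_pos rfl, if_pos rfl]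
    ring
  · rw [if_neg (by omega), if_neg hpq, mul_zero]

theorem integral_ball_of_polar_eq_mul {f : ℂ → ℂ} {u v : ℝ → ℂ} {r : ℝ} (hr : 0 ≤ r)
    (hf : ∀ ρ ∈ Set.Ioo 0 r, ∀ t : ℝ, f ((ρ : ℂ) * (Circle.exp t : ℂ)) = u ρ * v t) :
    ∫ z in Metric.ball (0 : ℂ) r, f z =
      (∫ ρ in (0 : ℝ)..r, (ρ : ℂ) * u ρ) * ∫ t in -Real.pi..Real.pi, v t := by
  have hpolar : ∀ x ∈ polarCoord.target,
      x.1 • (Metric.ball (0 : ℂ) r).indicator f (Complex.polarCoord.symm x) =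
        (Set.Iio r ×ˢ Set.univ).indicator (fun x : ℝ × ℝ => (x.1 : ℂ) * u x.1 * v x.2) x := by
    rintro ⟨ρ, t⟩ hx
    rw [polarCoord_target] at hx
    have hρ : 0 < ρ := hx.1
    have hsymm : Complex.polarCoord.symm (ρ, t) = (ρ : ℂ) * (Circle.exp t : ℂ) := by
      rw [Complex.polarCoord_symm_apply, Circle.coe_exp, Complex.exp_mul_I, Complex.ofReal_cos,
        Complex.ofReal_sin]
    have hnorm : ‖(ρ : ℂ) * (Circle.exp t : ℂ)‖ = ρ := by
      rw [norm_mul, Circle.norm_coe, mul_one, Complex.norm_real, Real.norm_of_nonneg hρ.le]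
    by_cases hρr : ρ < r
    · rw [hsymm, Set.indicator_of_mem (mem_ball_zero_iff.2 (hnorm.trans_lt hρr)),
        Set.indicator_of_mem (Set.mk_mem_prod (Set.mem_Iio.2 hρr) (Set.mem_univ t)),
        hf ρ ⟨hρ, hρr⟩, Complex.real_smul, mul_assoc]
    · rw [hsymm, Set.indicator_of_notMem fun h => hρr (hnorm ▸ mem_ball_zero_iff.1 h),
        Set.indicator_of_notMem fun h => hρr h.1, smul_zero]
  have hset : polarCoord.target ∩ Set.Iio r ×ˢ Set.univ =
      Set.Ioo 0 r ×ˢ Set.Ioo (-Real.pi) Real.pi := by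
    rw [polarCoord_target, Set.prod_inter_prod, Set.inter_univ, Set.Ioi_inter_Iio]
  rw [← integral_indicator measurableSet_ball, ← Complex.integral_comp_polarCoord_symm,
    setIntegral_congr_fun polarCoord.open_target.measurableSet hpolar,
    setIntegral_indicator (measurableSet_Iio.prod MeasurableSet.univ), hset,
    Measure.volume_eq_prod, setIntegral_prod_mul (fun ρ : ℝ => (ρ : ℂ) * u ρ) v,
    intervalIntegral.integral_of_le hr, intervalIntegral.integral_of_le (by linarith [Real.pi_pos]),
    integral_Ioc_eq_integral_Ioo, integral_Ioc_eq_integral_Ioo]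

/-- Up to the factor `2π`, the moments of the weight `(1 - |z|²)ⁱ` on the disc of radius `r`. -/
def radialIntegral (i p : ℕ) (r : ℝ) : ℝ := ∫ ρ in (0 : ℝ)..r, ρ ^ (2 * p + 1) * (1 - ρ ^ 2) ^ i

theorem integral_ball_moment (i : ℕ) {r : ℝ} (hr : 0 ≤ r) (p q : ℕ) :
    ∫ z in Metric.ball (0 : ℂ) r, z ^ p * conj z ^ q * (((1 - ‖z‖ ^ 2) ^ i : ℝ) : ℂ) =
      if p = q then 2 * Real.pi * (radialIntegral i p r : ℂ) else 0 := by
  have hangular := integral_exp_zpow (-Real.pi) ((p : ℤ) - q)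
  rw [show -Real.pi + 2 * Real.pi = Real.pi by ring] at hangular
  rw [integral_ball_of_polar_eq_mul (u := fun ρ => (ρ : ℂ) ^ (p + q) * (((1 - ρ ^ 2) ^ i : ℝ) : ℂ))
    (v := fun t => ((Circle.exp t ^ ((p : ℤ) - q) : Circle) : ℂ)) hr fun ρ hρ t => ?_, hangular]
  · rcases eq_or_ne p q with rfl | hpq
    · rw [sub_self, if_pos rfl, if_pos rfl, radialIntegral, mul_comm,
        ← intervalIntegral.integral_ofReal]
      congr 2
      ext ρ
      push_cast
      ring
    · rw [if_neg (by omega), if_neg hpq, mul_zero]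
  · rw [polar_pow_mul_conj_pow, norm_mul, Circle.norm_coe, mul_one, Complex.norm_real,
      Real.norm_of_nonneg hρ.1.le]
    ring

theorem continuous_radialIntegrand (i p : ℕ) :
    Continuous fun ρ : ℝ => ρ ^ (2 * p + 1) * (1 - ρ ^ 2) ^ i := by fun_prop

theorem radialIntegral_succ (i p : ℕ) (r : ℝ) :
    radialIntegral (i + 1) p r = radialIntegral i p r - radialIntegral i (p + 1) r := by
  rw [radialIntegral, radialIntegral, radialIntegral, ← intervalIntegral.integral_sub
    ((continuous_radialIntegrand i p).intervalIntegrable _ _)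
    ((continuous_radialIntegrand i (p + 1)).intervalIntegrable _ _)]
  exact intervalIntegral.integral_congr fun ρ _ => by ring

theorem radialIntegral_one (i p : ℕ) :
    radialIntegral i p 1 = (p ! * i ! : ℝ) / (2 * (p + i + 1)!) := by
  induction i generalizing p with
  | zero =>
    have := Nat.factorial_ne_zero p
    simp only [radialIntegral, pow_zero, mul_one, integral_pow, add_zero, Nat.factorial_succ,
      one_pow, ne_eq, Nat.succ_ne_zero, not_false_eq_true, zero_pow, sub_zero, Nat.factorial_zero]
    push_cast
    field_simp
    ring
  | succ i ih =>
    have := Nat.factorial_ne_zero (p + i + 1)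
    rw [radialIntegral_succ, ih, ih, show p + 1 + i + 1 = (p + i + 1) + 1 by ring,
      show p + (i + 1) + 1 = (p + i + 1) + 1 by ring, Nat.factorial_succ (p + i + 1),
      Nat.factorial_succ i, Nat.factorial_succ p]
    push_cast
    field_simp
    ring

theorem continuous_radialIntegral (i p : ℕ) : Continuous (radialIntegral i p) :=
  intervalIntegral.continuous_primitive
    (fun _ _ => (continuous_radialIntegrand i p).intervalIntegrable _ _) 0

theorem abs_radialIntegral_le_one (i p : ℕ) {r : ℝ} (hr0 : 0 ≤ r) (hr1 : r ≤ 1) :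
    |radialIntegral i p r| ≤ 1 := by
  have h := intervalIntegral.norm_integral_le_of_norm_le_const (a := 0) (b := r) (C := 1)
    (f := fun ρ : ℝ => ρ ^ (2 * p + 1) * (1 - ρ ^ 2) ^ i) (fun ρ hρ => by
      rw [Set.uIoc_of_le hr0] at hρ
      have hρ0 : 0 ≤ ρ := hρ.1.le
      have hρ1 : ρ ≤ 1 := hρ.2.trans hr1
      have hweight : 0 ≤ 1 - ρ ^ 2 := by nlinarith
      rw [Real.norm_of_nonneg (by positivity)]
      exact mul_le_one₀ (pow_le_one₀ hρ0 hρ1) (by positivity)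
        (pow_le_one₀ hweight (by nlinarith)))
  rw [one_mul, sub_zero, abs_of_nonneg hr0] at h
  exact h.trans hr1

/-! ### The weighted Dirichlet integrals as double series -/

/-- The term of index `(a, b)` of the double series that represents `D_{μ,i}(∑ gₙ zⁿ)`. -/
def pairingTerm (g : ℕ → ℂ) (c : ℤ → ℂ) (i : ℕ) (p : ℕ × ℕ) : ℂ :=
  g p.1 * conj (g p.2) * c ((p.2 : ℤ) - p.1) * (min p.1 p.2).choose i

theorem one_add_abs_sub_le_mul (a b : ℕ) :
    1 + |(((b : ℤ) - a : ℤ) : ℝ)| ≤ (1 + a) * (1 + b) := by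
  have h : |(((b : ℤ) - a : ℤ) : ℝ)| ≤ a + b := by
    push_cast
    rw [abs_le]
    constructor <;> linarith [a.cast_nonneg (α := ℝ), b.cast_nonneg (α := ℝ)]
  nlinarith [mul_nonneg (a.cast_nonneg (α := ℝ)) (b.cast_nonneg (α := ℝ))]

theorem choose_min_le_pow (a b i : ℕ) :
    ((min a b).choose i : ℝ) ≤ ((1 + a) * (1 + b) : ℝ) ^ i := by
  have h : min a b ≤ (1 + a) * (1 + b) := (min_le_left a b).trans (by nlinarith)
  exact_mod_cast (Nat.choose_le_pow _ _).trans (Nat.pow_le_pow_left h i)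

theorem RapidDecay.summable_norm_pairingTerm {g : ℕ → ℂ} (hg : RapidDecay g) (μ : Distribution)
    (i : ℕ) : Summable fun p => ‖pairingTerm g μ.coeff i p‖ := by
  obtain ⟨N, C, hc⟩ := μ.growth
  refine (((hg (N + i)).mul_of_nonneg (hg (N + i)) (fun _ => by positivity)
    fun _ => by positivity).mul_left C).of_nonneg_of_le (fun _ => norm_nonneg _) fun p => ?_
  have hC : 0 ≤ C := by simpa using (norm_nonneg _).trans (hc 0)
  rw [pairingTerm, norm_mul, norm_mul, norm_mul, RCLike.norm_conj, Complex.norm_natCast]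
  calc ‖g p.1‖ * ‖g p.2‖ * ‖μ.coeff ((p.2 : ℤ) - p.1)‖ * (min p.1 p.2).choose i
      ≤ ‖g p.1‖ * ‖g p.2‖ * (C * ((1 + p.1) * (1 + p.2)) ^ N) * ((1 + p.1) * (1 + p.2)) ^ i := by
        gcongr
        · exact (hc _).trans (by gcongr; exact one_add_abs_sub_le_mul _ _)
        · exact choose_min_le_pow _ _ _
    _ = _ := by simp only [mul_pow, pow_add]; ring

/-- The moment of order `n` of the radial measure against which `dirichletApprox μ i f r`
integrates `|f⁽ⁱ⁾|² P_μ`. -/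
def dirichletMoment : ℕ → ℕ → ℝ → ℝ
  | 0, n, r => r ^ (2 * n)
  | i + 1, n, r => 2 * radialIntegral i n r / ((i + 1)! * i !)

theorem continuous_dirichletMoment (i n : ℕ) : Continuous (dirichletMoment i n) := by
  cases i with
  | zero => exact continuous_pow _
  | succ i => exact ((continuous_radialIntegral i n).const_mul 2).div_const _

theorem abs_dirichletMoment_le_two (i n : ℕ) {r : ℝ} (hr0 : 0 ≤ r) (hr1 : r ≤ 1) :
    |dirichletMoment i n r| ≤ 2 := by
  cases i with
  | zero =>
    rw [dirichletMoment, abs_of_nonneg (by positivity)]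
    exact (pow_le_one₀ hr0 hr1).trans one_le_two
  | succ i =>
    have hfact : (1 : ℝ) ≤ ((i + 1)! * i ! : ℕ) := by
      exact_mod_cast Nat.mul_pos (Nat.factorial_pos _) (Nat.factorial_pos _)
    push_cast at hfact
    rw [dirichletMoment, abs_div, abs_mul, abs_two, abs_of_nonneg (zero_le_one.trans hfact)]
    exact (div_le_self (by positivity) hfact).trans
      (by linarith [abs_radialIntegral_le_one i n hr0 hr1])

theorem dirichletMoment_one (i n : ℕ) : dirichletMoment i n 1 = n ! / (i ! * (n + i)!) := by
  cases i with
  | zero => simp [dirichletMoment, Nat.factorial_ne_zero]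
  | succ i =>
    rw [dirichletMoment, radialIntegral_one, ← add_assoc]
    have := Nat.factorial_ne_zero i
    field_simp

theorem derivCoeff_mul_dirichletMoment_one (g : ℕ → ℂ) (c : ℤ → ℂ) (i : ℕ) (p : ℕ × ℕ) :
    derivCoeff g i p.1 * conj (derivCoeff g i p.2) * c ((p.2 : ℤ) - p.1) *
        dirichletMoment i (max p.1 p.2) 1 = pairingTerm g c i (p.1 + i, p.2 + i) := by
  have hmoment (a b : ℕ) : (((a + i).descFactorial i : ℝ) * (b + i).descFactorial i) *
      dirichletMoment i (max a b) 1 = (min (a + i) (b + i)).choose i := by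
    wlog hab : a ≤ b generalizing a b with H
    · rw [max_comm, min_comm, mul_comm ((a + i).descFactorial i : ℝ), H b a (by omega)]
    have hfact : (b ! : ℝ) * (b + i).descFactorial i = (b + i)! := by
      exact_mod_cast Nat.add_sub_cancel b i ▸ Nat.factorial_mul_descFactorial (Nat.le_add_left i b)
    rw [max_eq_right hab, min_eq_left (by omega), dirichletMoment_one,
      Nat.descFactorial_eq_factorial_mul_choose (a + i), ← hfact]
    have hb : (b ! : ℝ) * (b + i).descFactorial i ≠ 0 := hfact ▸ by positivity
    have hb' := right_ne_zero_of_mul hb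
    push_cast
    field_simp
  have h := congrArg (Complex.ofReal) (hmoment p.1 p.2)
  push_cast at h
  simp only [pairingTerm, derivCoeff, map_mul, map_natCast, ← h, Nat.cast_add,
    add_sub_add_right_eq_sub]
  ring

theorem tsum_pairingTerm_eq_tsum_derivCoeff (g : ℕ → ℂ) (c : ℤ → ℂ) (i : ℕ) :
    ∑' p, pairingTerm g c i p = ∑' p : ℕ × ℕ, derivCoeff g i p.1 * conj (derivCoeff g i p.2) *
      c ((p.2 : ℤ) - p.1) * dirichletMoment i (max p.1 p.2) 1 := by
  have hinj : Function.Injective fun p : ℕ × ℕ => (p.1 + i, p.2 + i) := fun p q h => by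
    simpa [Prod.ext_iff] using h
  simp only [derivCoeff_mul_dirichletMoment_one]
  refine (hinj.tsum_eq fun p hp => ?_).symm
  have h : i ≤ min p.1 p.2 := by
    by_contra! hlt
    exact hp (by rw [pairingTerm, Nat.choose_eq_zero_of_lt hlt, Nat.cast_zero, mul_zero])
  exact ⟨(p.1 - i, p.2 - i), Prod.ext (by dsimp only; omega) (by dsimp only; omega)⟩

section DirichletApprox

variable (μ : Distribution) (f : AnalyticTest) {r : ℝ}

theorem hasSum_dirichletApprox_zero (hr0 : 0 < r) (hr1 : r < 1) :
    HasSum (fun p : ℕ × ℕ => f.taylorCoeff p.1 * conj (f.taylorCoeff p.2) *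
      μ.coeff ((p.2 : ℤ) - p.1) * (r : ℂ) ^ (2 * max p.1 p.2)) (dirichletApprox μ 0 f r) := by
  obtain ⟨N, C, hc⟩ := μ.growth
  have hnorm (t : ℝ) : ‖(r : ℂ) * (Circle.exp t : ℂ)‖ ≤ r := by
    rw [norm_mul, Circle.norm_coe, mul_one, Complex.norm_real, Real.norm_of_nonneg hr0.le]
  have h := hasSum_integral_normSq_mul_poisson
    (ν := volume.restrict (Set.Ioc (0 : ℝ) (2 * Real.pi))) (w := fun _ => 1)
    (ζ := fun t => (r : ℂ) * (Circle.exp t : ℂ)) (Continuous.aestronglyMeasurable (by fun_prop))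
    (integrable_const 1) hr0.le hr1.le (Filter.Eventually.of_forall hnorm)
    f.rapidDecay_taylorCoeff.summable_norm (summable_norm_mul_pow_natAbs hc hr0 hr1)
    (M := fun p => 2 * Real.pi * (r : ℂ) ^ (2 * p))
    (by simpa only [mul_one] using integral_circle_moment r)
  simp only [dirichletApprox, f.extend_eq_powerSum]
  rw [intervalIntegral.integral_of_le (by positivity)]
  simp only [mul_one] at h
  refine (congrArg (HasSum · _) (funext fun p => ?_)).mpr (h.mul_left (2 * Real.pi : ℂ)⁻¹)
  field_simp

theorem hasSum_dirichletApprox_succ (i : ℕ) (hr0 : 0 < r) (hr1 : r < 1) :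
    HasSum (fun p : ℕ × ℕ => derivCoeff f.taylorCoeff (i + 1) p.1 *
      conj (derivCoeff f.taylorCoeff (i + 1) p.2) *
      μ.coeff ((p.2 : ℤ) - p.1) * dirichletMoment (i + 1) (max p.1 p.2) r)
      (dirichletApprox μ (i + 1) f r) := by
  obtain ⟨N, C, hc⟩ := μ.growth
  have hball : ∀ᵐ z ∂volume.restrict (Metric.ball (0 : ℂ) r), ‖z‖ < r :=
    (ae_restrict_mem measurableSet_ball).mono fun z hz => mem_ball_zero_iff.1 hz
  have hweight : IntegrableOn (fun z : ℂ => (((1 - ‖z‖ ^ 2) ^ i : ℝ) : ℂ)) (Metric.ball 0 r) :=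
    ((Continuous.continuousOn (by fun_prop)).integrableOn_compact
      (isCompact_closedBall 0 r)).mono_set Metric.ball_subset_closedBall
  have h := hasSum_integral_normSq_mul_poisson (ζ := fun z => z) aestronglyMeasurable_id hweight
    hr0.le hr1.le (hball.mono fun _ => le_of_lt)
    (f.rapidDecay_taylorCoeff.rapidDecay_derivCoeff (i + 1)).summable_norm
    (summable_norm_mul_pow_natAbs hc hr0 hr1) (integral_ball_moment i hr0.le)
  have hderiv : ∀ᵐ z ∂volume.restrict (Metric.ball (0 : ℂ) r), iteratedDeriv (i + 1) f.extend z =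
      powerSum (derivCoeff f.taylorCoeff (i + 1)) z :=
    hball.mono fun z hz => by
      rw [f.extend_eq_powerSum, f.rapidDecay_taylorCoeff.iteratedDeriv_powerSum _ (hz.trans hr1)]
  have hcongr : ∫ z in Metric.ball (0 : ℂ) r, ((‖iteratedDeriv (i + 1) f.extend z‖ ^ 2 : ℝ) : ℂ) *
      poisson μ.coeff z * (((1 - ‖z‖ ^ 2) ^ i : ℝ) : ℂ) = ∫ z in Metric.ball (0 : ℂ) r,
        ((‖powerSum (derivCoeff f.taylorCoeff (i + 1)) z‖ ^ 2 : ℝ) : ℂ) * poisson μ.coeff z *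
          (((1 - ‖z‖ ^ 2) ^ i : ℝ) : ℂ) :=
    integral_congr_ae (hderiv.mono fun z hz => by simp only [hz])
  rw [dirichletApprox, hcongr]
  refine (congrArg (HasSum · _) (funext fun p => ?_)).mpr
    (h.mul_left (Real.pi * (i + 1)! * i ! : ℂ)⁻¹)
  have hpi : (Real.pi : ℂ) ≠ 0 := by exact_mod_cast Real.pi_ne_zero
  simp only [dirichletMoment]
  push_cast
  field_simp

theorem dirichletApprox_eq_tsum (i : ℕ) (hr0 : 0 < r) (hr1 : r < 1) :
    dirichletApprox μ i f r = ∑' p : ℕ × ℕ, derivCoeff f.taylorCoeff i p.1 *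
      conj (derivCoeff f.taylorCoeff i p.2) *
      μ.coeff ((p.2 : ℤ) - p.1) * dirichletMoment i (max p.1 p.2) r := by
  cases i with
  | zero =>
    simpa only [derivCoeff_zero, dirichletMoment, Complex.ofReal_pow] using
      (hasSum_dirichletApprox_zero μ f hr0 hr1).tsum_eq.symm
  | succ i => exact (hasSum_dirichletApprox_succ μ f i hr0 hr1).tsum_eq.symm

theorem tendsto_dirichletApprox (i : ℕ) :
    Filter.Tendsto (dirichletApprox μ i f) (𝓝[<] 1)
      (𝓝 (∑' p, pairingTerm f.taylorCoeff μ.coeff i p)) := by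
  have hunit : ∀ᶠ r : ℝ in 𝓝[<] 1, r ∈ Set.Ioo (0 : ℝ) 1 := Ioo_mem_nhdsLT zero_lt_one
  rw [tsum_pairingTerm_eq_tsum_derivCoeff]
  refine Filter.Tendsto.congr' (hunit.mono fun r hr =>
    (dirichletApprox_eq_tsum μ f i hr.1 hr.2).symm) ?_
  refine tendsto_tsum_of_dominated_convergence
    (((f.rapidDecay_taylorCoeff.rapidDecay_derivCoeff i).summable_norm_pairingTerm μ 0).mul_right 2)
    (fun p => ?_) (hunit.mono fun r hr p => ?_)
  · exact (((Complex.continuous_ofReal.comp (continuous_dirichletMoment i _)).tendsto 1).mono_left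
      nhdsWithin_le_nhds).const_mul _
  · rw [pairingTerm, Nat.choose_zero_right, Nat.cast_one, mul_one, norm_mul _ (Complex.ofReal _),
      Complex.norm_real]
    gcongr
    exact abs_dirichletMoment_le_two i _ hr.1.le hr.2.le

theorem dirichletIntegral_eq_tsum (i : ℕ) :
    dirichletIntegral μ i f = ∑' p, pairingTerm f.taylorCoeff μ.coeff i p :=
  (tendsto_dirichletApprox μ f i).limUnder_eq

end DirichletApprox

/-! ### The model of a higher order isometry with a cyclic vector -/

/-- The analytic test function `zᵃ`. -/
def AnalyticTest.pow (a : ℕ) : AnalyticTest :=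
  ⟨monomial a, fun k hk => by rw [coeff_monomial, if_neg (by omega)]⟩

namespace AnalyticTest

theorem taylorCoeff_add (f g : AnalyticTest) (n : ℕ) :
    (f + g).taylorCoeff n = f.taylorCoeff n + g.taylorCoeff n := TestFun.coeff_add _ _ _

theorem taylorCoeff_smul (c : ℂ) (f : AnalyticTest) (n : ℕ) :
    (c • f).taylorCoeff n = c * f.taylorCoeff n := TestFun.coeff_smul _ _ _

theorem taylorCoeff_pow (a n : ℕ) :
    (AnalyticTest.pow a).taylorCoeff n = if n = a then 1 else 0 := by
  simp [taylorCoeff, AnalyticTest.pow, coeff_monomial]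

theorem taylorCoeff_mulZ_zero (f : AnalyticTest) : f.mulZ.taylorCoeff 0 = 0 :=
  (TestFun.coeff_mulZ _ _).trans (f.2 _ (by norm_num))

theorem taylorCoeff_mulZ_succ (f : AnalyticTest) (n : ℕ) :
    f.mulZ.taylorCoeff (n + 1) = f.taylorCoeff n :=
  (TestFun.coeff_mulZ _ _).trans (by push_cast; rw [add_sub_cancel_right]; rfl)

end AnalyticTest

theorem norm_sq_eq_tsum_of_hasSum {H : Type*} [NormedAddCommGroup H] [InnerProductSpace ℂ H]
    {c : ℕ → ℂ} {e : ℕ → H} {x : H} (hx : HasSum (fun n => c n • e n) x)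
    (hS : Summable fun p : ℕ × ℕ => c p.1 * (conj (c p.2) * inner ℂ (e p.2) (e p.1))) :
    ((‖x‖ ^ 2 : ℝ) : ℂ) = ∑' p : ℕ × ℕ, c p.1 * (conj (c p.2) * inner ℂ (e p.2) (e p.1)) := by
  have hleft (y : H) : HasSum (fun n => conj (c n) * inner ℂ (e n) y) (inner ℂ x y) := by
    simpa only [innerSL_apply_apply, Function.comp_def, inner_smul_left, inner_conj_symm] using
      ((innerSL ℂ y).hasSum hx).map (starRingEnd ℂ) Complex.continuous_conj
  have hright : HasSum (fun n => c n * inner ℂ x (e n)) (inner ℂ x x) := by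
    simpa only [innerSL_apply_apply, Function.comp_def, inner_smul_right] using
      (innerSL ℂ x).hasSum hx
  rw [hS.tsum_prod]
  simp only [tsum_mul_left, (hleft _).tsum_eq, hright.tsum_eq]
  rw [inner_self_eq_norm_sq_to_K]
  push_cast
  rfl

section Model

variable {H : Type*} [NormedAddCommGroup H] [InnerProductSpace ℂ H] [CompleteSpace H]
  {T : H →L[ℂ] H} {n : ℕ}

section OrbitMap

theorem summable_taylorCoeff_smul_pow (hT : defect T n = 0) (e : H) (f : AnalyticTest) :
    Summable fun k => f.taylorCoeff k • (T ^ k) e := by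
  obtain ⟨C, hC⟩ := exists_norm_pow_le_of_defect_eq_zero hT e
  refine Summable.of_norm_bounded ((f.rapidDecay_taylorCoeff n).mul_left C) fun k => ?_
  rw [norm_smul, mul_left_comm]
  exact mul_le_mul_of_nonneg_left (hC k) (norm_nonneg _)

/-- The map `f ↦ f(T) e` on analytic test functions, defined by the Taylor series of `f`. It
converges for every `f` because the orbit of `e` under an `n`-isometry grows polynomially. -/
def orbitMap (hT : defect T n = 0) (e : H) : AnalyticTest →ₗ[ℂ] H where
  toFun f := ∑' k, f.taylorCoeff k • (T ^ k) e
  map_add' f g := by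
    simp only [AnalyticTest.taylorCoeff_add, add_smul]
    exact (summable_taylorCoeff_smul_pow hT e f).tsum_add (summable_taylorCoeff_smul_pow hT e g)
  map_smul' c f := by
    simp only [AnalyticTest.taylorCoeff_smul, mul_smul]
    exact (summable_taylorCoeff_smul_pow hT e f).tsum_const_smul c

variable (hT : defect T n = 0) (e : H)

theorem hasSum_orbitMap (f : AnalyticTest) :
    HasSum (fun k => f.taylorCoeff k • (T ^ k) e) (orbitMap hT e f) :=
  (summable_taylorCoeff_smul_pow hT e f).hasSum

theorem orbitMap_pow (a : ℕ) : orbitMap hT e (AnalyticTest.pow a) = (T ^ a) e := by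
  refine (hasSum_orbitMap hT e _).unique ?_
  simp only [AnalyticTest.taylorCoeff_pow, ite_smul, one_smul, zero_smul]
  convert hasSum_ite_eq a ((T ^ a) e) using 3 with k hk
  rw [hk]

theorem orbitMap_one : orbitMap hT e AnalyticTest.one = e := orbitMap_pow hT e 0

theorem orbitMap_mulZ (f : AnalyticTest) : orbitMap hT e f.mulZ = T (orbitMap hT e f) := by
  refine (hasSum_orbitMap hT e f.mulZ).unique ?_
  have h := T.hasSum (hasSum_orbitMap hT e f)
  rw [← hasSum_nat_add_iff' 1]
  simpa only [Finset.range_one, Finset.sum_singleton, f.taylorCoeff_mulZ_zero, zero_smul, sub_zero,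
    f.taylorCoeff_mulZ_succ, pow_succ', mul_apply_eq_comp, map_smul] using h

theorem denseRange_orbitMap {e : H} (he : IsCyclicVector T e) : DenseRange (orbitMap hT e) := by
  have hspan : Submodule.span ℂ (Set.range fun k : ℕ => (T ^ k) e) ≤
      LinearMap.range (orbitMap hT e) := by
    rw [Submodule.span_le]
    rintro _ ⟨k, rfl⟩
    exact ⟨AnalyticTest.pow k, orbitMap_pow hT e k⟩
  exact (Submodule.dense_iff_topologicalClosure_eq_top.2 he).mono hspan

end OrbitMap

namespace IsTupleOf

variable {e : H} {μ : Fin n → Distribution}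

theorem eq {ν : Fin n → Distribution} (hμ : IsTupleOf T e μ) (hν : IsTupleOf T e ν) : μ = ν := by
  funext i
  refine Distribution.ext_coeff fun k => ?_
  obtain ⟨k, rfl | rfl⟩ := k.eq_nat_or_neg
  · rw [(hμ i k).1, (hν i k).1]
  · exact (starRingEnd ℂ).injective ((hμ i k).2.trans (hν i k).2.symm)

theorem inner_pow (hμ : IsTupleOf T e μ) (hT : defect T n = 0) (a b : ℕ) :
    inner ℂ ((T ^ b) e) ((T ^ a) e) =
      ∑ i : Fin n, ((min a b).choose i : ℂ) * (μ i).coeff ((b : ℤ) - a) := by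
  have hle (a k : ℕ) : inner ℂ ((T ^ (a + k)) e) ((T ^ a) e) =
      ∑ i : Fin n, (a.choose i : ℂ) * (μ i).coeff k := by
    rw [pow_add, mul_apply_eq_comp, inner_pow_eq_sum_defect_of_defect_eq_zero hT,
      Finset.sum_range]
    simp only [(hμ _ k).1]
  rcases le_total a b with h | h
  · obtain ⟨k, rfl⟩ := Nat.exists_eq_add_of_le h
    rw [hle, min_eq_left h, Nat.cast_add, add_sub_cancel_left]
  · obtain ⟨k, rfl⟩ := Nat.exists_eq_add_of_le h
    rw [← inner_conj_symm, hle, min_eq_right h, map_sum, Nat.cast_add, sub_add_cancel_left]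
    refine Finset.sum_congr rfl fun i _ => ?_
    rw [map_mul, map_natCast, (hμ i k).1, ← (hμ i k).2, Complex.conj_conj]

theorem norm_sq_orbitMap (hμ : IsTupleOf T e μ) (hT : defect T n = 0) (f : AnalyticTest) :
    ((‖orbitMap hT e f‖ ^ 2 : ℝ) : ℂ) = tupleForm μ f := by
  have hterm (p : ℕ × ℕ) : ∑ i : Fin n, pairingTerm f.taylorCoeff (μ i).coeff i p =
      f.taylorCoeff p.1 * (conj (f.taylorCoeff p.2) * inner ℂ ((T ^ p.2) e) ((T ^ p.1) e)) := by
    rw [hμ.inner_pow hT, Finset.mul_sum, Finset.mul_sum]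
    refine Finset.sum_congr rfl fun i _ => ?_
    rw [pairingTerm]
    ring
  have hsummable (i : Fin n) : Summable (pairingTerm f.taylorCoeff (μ i).coeff i) :=
    (f.rapidDecay_taylorCoeff.summable_norm_pairingTerm (μ i) i).of_norm
  have hS := summable_sum fun (i : Fin n) (_ : i ∈ Finset.univ) => hsummable i
  simp only [hterm] at hS
  rw [norm_sq_eq_tsum_of_hasSum (hasSum_orbitMap hT e f) hS]
  simp only [tupleForm, dirichletIntegral_eq_tsum, ← hterm]
  exact Summable.tsum_finsetSum fun i _ => hsummable i

theorem isModelMap_orbitMap (hμ : IsTupleOf T e μ) (hT : defect T n = 0)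
    (he : IsCyclicVector T e) : IsModelMap μ T e (orbitMap hT e) where
  norm_sq := hμ.norm_sq_orbitMap hT
  dense := denseRange_orbitMap hT he
  map_mulZ := orbitMap_mulZ hT e
  map_one := orbitMap_one hT e

open scoped ComplexOrder in
theorem isNormalizedAllowable (hμ : IsTupleOf T e μ) (hT : defect T n = 0) (he : ‖e‖ = 1) :
    IsNormalizedAllowable μ where
  tendsto i f := by
    rw [dirichletIntegral_eq_tsum]
    exact tendsto_dirichletApprox _ _ _
  form_one := by
    rw [← hμ.norm_sq_orbitMap hT, orbitMap_one, he, one_pow, Complex.ofReal_one]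
  bounded := by
    refine ⟨‖T‖ ^ 2 + 1, by positivity, fun f => ?_⟩
    rw [← hμ.norm_sq_orbitMap hT, ← hμ.norm_sq_orbitMap hT, orbitMap_mulZ]
    refine ⟨Complex.zero_le_real.2 (by positivity), ?_⟩
    rw [← Complex.ofReal_mul, Complex.real_le_real]
    calc ‖T (orbitMap hT e f)‖ ^ 2 ≤ (‖T‖ * ‖orbitMap hT e f‖) ^ 2 := by
          gcongr
          exact T.le_opNorm _
      _ = ‖T‖ ^ 2 * ‖orbitMap hT e f‖ ^ 2 := mul_pow _ _ _
      _ ≤ (‖T‖ ^ 2 + 1) * ‖orbitMap hT e f‖ ^ 2 := by gcongr; linarith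

end IsTupleOf

end Model

/-! ### The tuple of the local Dirichlet space -/

/-- The tuple `(μ₀, …, μ_{2m-1})` of the shift on `D_λ^m`. -/
def localTuple (m : ℕ) (lam : Circle) (i : Fin (2 * m)) : Distribution :=
  if (i : ℕ) = 0 then lebesgue else localDistribution m lam i

theorem localTuple_of_ne_zero {m : ℕ} (lam : Circle) {i : Fin (2 * m)} (hi : (i : ℕ) ≠ 0) :
    localTuple m lam i = localDistribution m lam i := if_neg hi

namespace LocalDirichlet

variable {m : ℕ} (lam : Circle) (hm : 1 ≤ m)

theorem isTupleOf_localTuple : IsTupleOf (shift m lam) (one m lam hm) (localTuple m lam) := by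
  rintro ⟨i, hi⟩ k
  rcases i with _ | i
  · have h0 : localTuple m lam ⟨0, hi⟩ = lebesgue := if_pos rfl
    rw [h0, coeff_lebesgue, coeff_lebesgue, defect, ContinuousLinearMap.id_apply,
      inner_shift_pow_one]
    by_cases hk : k = 0 <;> simp [hk]
  · rw [localTuple_of_ne_zero lam i.succ_ne_zero, inner_defect_succ_one lam hm k hi,
      coeff_localDistribution lam (by omega) hi, coeff_localDistribution lam (by omega) hi,
      Int.natAbs_neg, Int.natAbs_natCast, neg_neg, Nat.add_sub_cancel,
      show 2 * m - 1 - (i + 1) = 2 * (m - 1) - i by omega, zpow_neg, zpow_natCast]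
    constructor
    · rw [Circle.coe_inv_eq_conj, Circle.coe_pow, map_pow, mul_comm]
    · rw [map_mul, Circle.coe_pow, map_pow, map_natCast, mul_comm]

/-- Evaluation at a point of the disc, as a bounded functional on `D_λ^m`. -/
def evalCLM (m : ℕ) (lam : Circle) {z : ℂ} (hz : ‖z‖ < 1) : LocalDirichlet m lam →L[ℂ] ℂ where
  toFun F := eval F z
  map_add' F G := eval_add F G z hz
  map_smul' c F := eval_smul c F z hz
  cont := continuous_eval z hz

theorem eval_orbitMap_shift_one (f : AnalyticTest) {z : ℂ} (hz : ‖z‖ < 1) :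
    eval (orbitMap (defect_shift_eq_zero lam hm) (one m lam hm) f) z = f.extend z := by
  have h := (evalCLM m lam hz).hasSum (hasSum_orbitMap (defect_shift_eq_zero lam hm)
    (one m lam hm) f)
  have hterm (n : ℕ) : evalCLM m lam hz (f.taylorCoeff n • (shift m lam ^ n) (one m lam hm)) =
      f.taylorCoeff n * z ^ n := by
    rw [map_smul, smul_eq_mul]
    exact congrArg _ (eval_shift_pow_one lam hm n z hz)
  simp only [hterm] at h
  rw [f.extend_eq_powerSum]
  exact h.tsum_eq.symm

end LocalDirichlet

end HigherDirichlet

end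

theorem mainTheorem6 (m : ℕ) (hm : 1 ≤ m) (lam : Circle) :
    -- `M_z` on `D_λ^m` is an expansive strict `2m`-isometry with cyclic unit vector `1`
    HigherDirichlet.IsExpansive (HigherDirichlet.shift m lam) ∧
    HigherDirichlet.IsStrictIsometry (HigherDirichlet.shift m lam) (2 * m) ∧
    ‖HigherDirichlet.LocalDirichlet.one m lam hm‖ = 1 ∧
    HigherDirichlet.IsCyclicVector (HigherDirichlet.shift m lam)
      (HigherDirichlet.LocalDirichlet.one m lam hm) ∧
    ∃ μ : Fin (2 * m) → HigherDirichlet.Distribution,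
      -- `μ` is the tuple of `M_z`, and no other tuple is
      (∀ ν : Fin (2 * m) → HigherDirichlet.Distribution,
        HigherDirichlet.IsTupleOf (HigherDirichlet.shift m lam)
          (HigherDirichlet.LocalDirichlet.one m lam hm) ν ↔ ν = μ) ∧
      -- it is a normalized allowable tuple
      HigherDirichlet.IsNormalizedAllowable μ ∧
      -- `D_λ^m` is the space `D_μ`, the inclusion of the analytic test functions being the map `J`
      (∃ J : HigherDirichlet.AnalyticTest →ₗ[ℂ] HigherDirichlet.LocalDirichlet m lam,
        HigherDirichlet.IsModelMap μ (HigherDirichlet.shift m lam)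
          (HigherDirichlet.LocalDirichlet.one m lam hm) J ∧
        ∀ (f : HigherDirichlet.AnalyticTest) (z : ℂ), ‖z‖ < 1 →
          HigherDirichlet.LocalDirichlet.eval (J f) z = f.extend z) ∧
      -- the explicit form of the tuple
      (∀ i : Fin (2 * m), (i : ℕ) = 0 → μ i = HigherDirichlet.lebesgue) ∧
      (∀ i : Fin (2 * m), 1 ≤ (i : ℕ) → (i : ℕ) ≤ 2 * m - 2 →
        μ i = ((Nat.choose (i - 1) (m - 1) : ℂ) / (Nat.factorial (2 * m - 1 - i) : ℂ)) •
          HigherDirichlet.prodAbsDeriv ((i : ℤ) + 1 - m) ((m : ℤ) - 1)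
            (HigherDirichlet.dirac lam)) ∧
      (∀ i : Fin (2 * m), (i : ℕ) = 2 * m - 1 →
        μ i = (Nat.choose (2 * m - 2) (m - 1) : ℂ) • HigherDirichlet.dirac lam) ∧
      -- vanishing and orders
      (∀ i : Fin (2 * m), 1 ≤ (i : ℕ) → (i : ℕ) ≤ m - 1 → μ i = 0) ∧
      (∀ i : Fin (2 * m), m ≤ (i : ℕ) → (μ i).HasOrder (2 * m - 1 - i)) := by
  have hT := HigherDirichlet.LocalDirichlet.defect_shift_eq_zero lam hm
  have hnorm := HigherDirichlet.LocalDirichlet.norm_one lam hm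
  have hcyclic := HigherDirichlet.LocalDirichlet.isCyclicVector_one lam hm
  have htuple := HigherDirichlet.LocalDirichlet.isTupleOf_localTuple lam hm
  refine ⟨HigherDirichlet.LocalDirichlet.isExpansive_shift m lam,
    HigherDirichlet.LocalDirichlet.isStrictIsometry_shift lam hm, hnorm, hcyclic,
    HigherDirichlet.localTuple m lam, fun ν => ⟨fun hν => hν.eq htuple, fun hν => hν ▸ htuple⟩,
    htuple.isNormalizedAllowable hT hnorm,
    ⟨HigherDirichlet.orbitMap hT _, htuple.isModelMap_orbitMap hT hcyclic,
      fun f _ => HigherDirichlet.LocalDirichlet.eval_orbitMap_shift_one lam hm f⟩,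
    fun i hi => if_pos hi, fun i hi _ => HigherDirichlet.localTuple_of_ne_zero lam (by omega),
    fun i hi => ?_, fun i h0 hi => ?_, fun i hi => ?_⟩
  · rw [HigherDirichlet.localTuple_of_ne_zero lam (by omega), hi]
    exact HigherDirichlet.localDistribution_last lam hm
  · rw [HigherDirichlet.localTuple_of_ne_zero lam (by omega)]
    exact HigherDirichlet.localDistribution_eq_zero lam h0 hi
  · rw [HigherDirichlet.localTuple_of_ne_zero lam (by omega)]
    exact HigherDirichlet.hasOrder_localDistribution lam hi i.2
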